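/- **Theorem (Cross-constraint low basis).** Fix $r\in\mathbb N$. *Definitions.* Let $\mathcal X=3^{\mathbb N}\times(2^{\mathbb N})^r$ and $\mathcal X_{<\mathbb N}=3^{<\mathbb N}\times(2^{<\mathbb N})^r$. Call a pair $(\rho,\sigma)\in\mathcal X_{<\mathbb N}$ *balanced* if $|\sigma_i|=|\sigma_j|$ for all $i<j<r$ and $\max_{i<r}|\sigma_i|\le|\rho|$ (the maximum being $0$ if $r=0$). A *cross-tree* is a set $T\subseteq\mathcal X_{<\mathbb N}$ of balanced pairs such that every balanced pair that is componentwise a prefix of an element of $T$ is in $T$. A *path* of $T$ is a pair $(X,Y)\in\mathcal X$ such that $(X{\upharpoonright}_n,(Y_s{\upharpoonright}_n)_{s<r})\in T$ for all $n\in\mathbb N$; $T$ is *left-full* if for every $X\in3^{\mathbb N}$ there is $Y\in(2^{\mathbb N})^r$ such that $(X,Y)$ is a path of $T$. Two colorings $f,g:\mathbb N\to k$ are *finitely compatible* if $f^{-1}(i)\cap g^{-1}(i)$ is finite for every $i<k$, and *infinitely compatible* otherwise. The *cross-constraint problem* $\mathsf{CC}$ has as instances the left-full cross-trees $T$; a *solution*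 of $T$ is a pair $(X^i,Y^i)_{i<2}$ of paths of $T$ such that $X^0,X^1$ are finitely compatible and, for every $s<r$, $Y^0_s,Y^1_s$ are infinitely compatible. Finite objects and elements of $\mathcal X$ are coded by natural numbers and by sets of natural numbers in a standard effective way. A set $A\subseteq\mathbb N$ is *low* if $A'\le_T\emptyset'$. A *Turing ideal* is a nonempty family $\mathcal M\subseteq\mathcal P(\mathbb N)$ closed under $\oplus$ and downward closed under $\le_T$. A *cross-constraint ideal* is a Turing ideal $\mathcal M$ such that every instance $T\in\mathcal M$ of $\mathsf{CC}$ has a solution $(X^i,Y^i)_{i<2}$ with $(X^0,Y^0)\oplus(X^1,Y^1)\in\mathcal M$. *Claim.* 1. Every computable instance $T$ of $\mathsf{CC}$ (that is, every computable left-full cross-tree) has a solution $(X^i,Y^i)_{i<2}$ such that $(X^0,Y^0)\oplus(X^1,Y^1)$ is low. 2. There is a cross-constraint ideal all of whose elements are low. -/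

import Mathlib

/-! ### Oracle computability on sets of natural numbers -/

section Oracle

open Classical in
/-- The characteristic function of a set of natural numbers, as a (total) partial function. -/
noncomputable def charFun (A : Set ℕ) : ℕ →. ℕ :=
  fun n => Part.some (if n ∈ A then 1 else 0)

/-- Turing reducibility `A ≤_T B` between sets of natural numbers. -/
def SetTuringLE (A B : Set ℕ) : Prop :=
  TuringReducible (charFun A) (charFun B)

/-- The effective join `A ⊕ B = {2n : n ∈ A} ∪ {2n+1 : n ∈ B}`. -/
def setJoin (A B : Set ℕ) : Set ℕ :=
  {m | (∃ n ∈ A, m = 2 * n) ∨ (∃ n ∈ B, m = 2 * n + 1)}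

/-- Programs for oracle machines: one constructor for each clause of `Nat.RecursiveIn`. -/
inductive OracleCode : Type
  | zero : OracleCode
  | succ : OracleCode
  | left : OracleCode
  | right : OracleCode
  | oracle : OracleCode
  | pair : OracleCode → OracleCode → OracleCode
  | comp : OracleCode → OracleCode → OracleCode
  | prec : OracleCode → OracleCode → OracleCode
  | rfind : OracleCode → OracleCode

namespace OracleCode

/-- The partial function computed by a program with oracle `g`. -/
def eval (g : ℕ →. ℕ) : OracleCode → (ℕ →. ℕ)
  | zero => fun _ => Part.some 0
  | succ => fun n => Part.some (n + 1)
  | left => fun n => Part.some (Nat.unpair n).1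
  | right => fun n => Part.some (Nat.unpair n).2
  | oracle => g
  | pair c d => fun n => Nat.pair <$> eval g c n <*> eval g d n
  | comp c d => fun n => eval g d n >>= eval g c
  | prec c d => fun p =>
      let (a, n) := Nat.unpair p
      n.rec (eval g c a) fun y IH => do
        let i ← IH
        eval g d (Nat.pair a (Nat.pair y i))
  | rfind c => fun a =>
      Nat.rfind fun n => (fun m => m = 0) <$> eval g c (Nat.pair a n)

/-- The Gödel number of a program. -/
def index : OracleCode → ℕ
  | zero => 0
  | succ => 1
  | left => 2
  | right => 3
  | oracle => 4
  | pair c d => 4 * Nat.pair c.index d.index + 5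
  | comp c d => 4 * Nat.pair c.index d.index + 6
  | prec c d => 4 * Nat.pair c.index d.index + 7
  | rfind c => 4 * c.index + 8

/-- Every natural number is the Gödel number of exactly one program. -/
theorem index_bijective : Function.Bijective index := by
  constructor
  · intro c
    induction c with
    | zero | succ | left | right | oracle =>
      intro d h
      cases d <;> simp only [index] at h <;> first | rfl | omega
    | pair a b iha ihb | comp a b iha ihb | prec a b iha ihb =>
      intro d h
      cases d <;> simp only [index] at h <;> try omega
      rename_i a' b'
      have h' : Nat.pair a.index b.index = Nat.pair a'.index b'.index := by omega
      obtain ⟨h1, h2⟩ := Nat.pair_eq_pair.1 h'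
      rw [iha h1, ihb h2]
    | rfind a iha =>
      intro d h
      cases d <;> simp only [index] at h <;> try omega
      rename_i a'
      have h' : a.index = a'.index := by omega
      rw [iha h']
  · intro n
    induction n using Nat.strong_induction_on with
    | _ n ih =>
      by_cases hn : n < 5
      · interval_cases n
        exacts [⟨zero, rfl⟩, ⟨succ, rfl⟩, ⟨left, rfl⟩, ⟨right, rfl⟩, ⟨oracle, rfl⟩]
      · set m := (n - 5) / 4 with hm
        have h1 := Nat.unpair_left_le m
        have h2 := Nat.unpair_right_le m
        obtain ⟨a, ha⟩ := ih m.unpair.1 (by omega)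
        obtain ⟨b, hb⟩ := ih m.unpair.2 (by omega)
        obtain ⟨c, hc⟩ := ih m (by omega)
        have hp : Nat.pair a.index b.index = m := by rw [ha, hb, Nat.pair_unpair]
        have h4 : (n - 5) % 4 < 4 := Nat.mod_lt _ (by norm_num)
        have h5 := Nat.div_add_mod (n - 5) 4
        rcases (by omega : (n - 5) % 4 = 0 ∨ (n - 5) % 4 = 1 ∨ (n - 5) % 4 = 2 ∨
          (n - 5) % 4 = 3) with h | h | h | h
        · exact ⟨pair a b, by simp only [index, hp]; omega⟩
        · exact ⟨comp a b, by simp only [index, hp]; omega⟩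
        · exact ⟨prec a b, by simp only [index, hp]; omega⟩
        · exact ⟨rfind c, by simp only [index, hc]; omega⟩

/-- The functions computed by programs with oracle `g` are exactly the functions recursive
in `g`. -/
theorem recursiveIn_iff_exists_eval (g f : ℕ →. ℕ) :
    Nat.RecursiveIn {g} f ↔ ∃ c : OracleCode, eval g c = f := by
  constructor
  · intro h
    induction h with
    | zero => exact ⟨zero, rfl⟩
    | succ => exact ⟨succ, rfl⟩
    | left => exact ⟨left, rfl⟩
    | right => exact ⟨right, rfl⟩
    | oracle k hk => exact ⟨oracle, (Set.mem_singleton_iff.1 hk).symm⟩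
    | pair _ _ h1 h2 =>
      obtain ⟨c, rfl⟩ := h1
      obtain ⟨d, rfl⟩ := h2
      exact ⟨pair c d, rfl⟩
    | comp _ _ h1 h2 =>
      obtain ⟨c, rfl⟩ := h1
      obtain ⟨d, rfl⟩ := h2
      exact ⟨comp c d, rfl⟩
    | prec _ _ h1 h2 =>
      obtain ⟨c, rfl⟩ := h1
      obtain ⟨d, rfl⟩ := h2
      exact ⟨prec c d, rfl⟩
    | rfind _ h1 =>
      obtain ⟨c, rfl⟩ := h1
      exact ⟨rfind c, rfl⟩
  · rintro ⟨c, rfl⟩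
    induction c with
    | zero => exact .zero
    | succ => exact .succ
    | left => exact .left
    | right => exact .right
    | oracle => exact .oracle g rfl
    | pair _ _ h1 h2 => exact .pair h1 h2
    | comp _ _ h1 h2 => exact .comp h1 h2
    | prec _ _ h1 h2 => exact .prec h1 h2
    | rfind _ h1 => exact .rfind h1

end OracleCode

/-- The Turing jump `A' = {e : Φ_e^A(e)↓}`. -/
def turingJump (A : Set ℕ) : Set ℕ :=
  {e | ∃ c : OracleCode, c.index = e ∧ (c.eval (charFun A) e).Dom}

/-- `A` is low if `A' ≤_T ∅'`. -/
def IsLow (A : Set ℕ) : Prop :=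
  SetTuringLE (turingJump A) (turingJump ∅)

/-- A Turing ideal: a nonempty family of sets closed under join and downward closed under
Turing reducibility. -/
structure IsTuringIdeal (M : Set (Set ℕ)) : Prop where
  nonempty : M.Nonempty
  join_mem : ∀ A ∈ M, ∀ B ∈ M, setJoin A B ∈ M
  down_closed : ∀ A ∈ M, ∀ B : Set ℕ, SetTuringLE B A → B ∈ M

/-- The set of natural numbers coding a set of elements of a type with a primitive recursive
coding. -/
def codeSet {α : Type} [Primcodable α] (S : Set α) : Set ℕ :=
  {n | ∃ a ∈ S, Encodable.encode a = n}

end Oracle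

/-! ### Cross-trees and the cross-constraint problem -/

section CrossConstraint

/-- Pairs `(ρ, σ)` of a 3-valued string and an `r`-tuple of 2-valued strings. -/
abbrev CrossString (r : ℕ) : Type := List (Fin 3) × (Fin r → List (Fin 2))

/-- Pairs `(X, Y)` of a 3-valued sequence and an `r`-tuple of 2-valued sequences. -/
abbrev CrossSeq (r : ℕ) : Type := (ℕ → Fin 3) × (Fin r → ℕ → Fin 2)

/-- The length of a tuple of strings: the maximum of the lengths (`0` for the empty tuple). -/
def tupleLength {r : ℕ} (σ : Fin r → List (Fin 2)) : ℕ :=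
  Finset.univ.sup fun s => (σ s).length

/-- The shape required of the elements of a cross-tree: all components of `σ` have the same
length, and `|σ| ≤ |ρ|`. -/
def CrossString.IsBalanced {r : ℕ} (χ : CrossString r) : Prop :=
  (∀ i j : Fin r, (χ.2 i).length = (χ.2 j).length) ∧ tupleLength χ.2 ≤ χ.1.length

/-- The componentwise prefix relation. -/
def CrossString.IsPrefix {r : ℕ} (χ ψ : CrossString r) : Prop :=
  χ.1 <+: ψ.1 ∧ ∀ s : Fin r, χ.2 s <+: ψ.2 s

/-- A cross-tree: a set of balanced pairs, downward closed (among balanced pairs) under the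
prefix relation. -/
structure IsCrossTree {r : ℕ} (T : Set (CrossString r)) : Prop where
  balanced : ∀ χ ∈ T, χ.IsBalanced
  down_closed : ∀ ψ ∈ T, ∀ χ : CrossString r, χ.IsBalanced → χ.IsPrefix ψ → χ ∈ T

/-- The initial segment of length `n` of an infinite sequence. -/
def initSeg {α : Type} (X : ℕ → α) (n : ℕ) : List α := (List.range n).map X

/-- The class `[T]` of infinite paths of `T`. -/
def crossPaths {r : ℕ} (T : Set (CrossString r)) : Set (CrossSeq r) :=
  {P | ∀ n : ℕ, (initSeg P.1 n, fun s => initSeg (P.2 s) n) ∈ T}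

/-- `T` is left-full: every 3-valued sequence `X` is the left part of a path `(X, Y)` of `T`. -/
def IsLeftFull {r : ℕ} (T : Set (CrossString r)) : Prop :=
  ∀ X : ℕ → Fin 3, ∃ Y : Fin r → ℕ → Fin 2, (X, Y) ∈ crossPaths T

/-- Two colorings of `ℕ` are finitely compatible if for every color `i` only finitely many
numbers have color `i` in both. -/
def FinitelyCompatible {k : ℕ} (f g : ℕ → Fin k) : Prop :=
  ∀ i : Fin k, (f ⁻¹' {i} ∩ g ⁻¹' {i}).Finite

/-- Two colorings of `ℕ` are infinitely compatible if they are not finitely compatible. -/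
def InfinitelyCompatible {k : ℕ} (f g : ℕ → Fin k) : Prop :=
  ¬ FinitelyCompatible f g

/-- The instances of the cross-constraint problem: left-full cross-trees. -/
structure IsCCInstance {r : ℕ} (T : Set (CrossString r)) : Prop where
  crossTree : IsCrossTree T
  leftFull : IsLeftFull T

/-- The solutions of an instance `T` of the cross-constraint problem: pairs of paths
`P = (X⁰, Y⁰)`, `Q = (X¹, Y¹)` of `T` such that `X⁰, X¹` are finitely compatible and
`Y⁰_s, Y¹_s` are infinitely compatible for every `s < r`. -/
structure IsCCSolution {r : ℕ} (T : Set (CrossString r)) (P Q : CrossSeq r) : Prop where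
  left_path : P ∈ crossPaths T
  right_path : Q ∈ crossPaths T
  finitelyCompatible : FinitelyCompatible P.1 Q.1
  infinitelyCompatible : ∀ s : Fin r, InfinitelyCompatible (P.2 s) (Q.2 s)

/-- A pair `(X, Y)` as a set of natural numbers: the coded graph of
`n ↦ (X(n), (Y_s(n))_{s<r})`. -/
def seqSet {r : ℕ} (P : CrossSeq r) : Set ℕ :=
  codeSet {p : ℕ × (Fin 3 × (Fin r → Fin 2)) | p.2 = (P.1 p.1, fun s => P.2 s p.1)}

/-- A cross-constraint ideal: a Turing ideal `M` in which every instance of the cross-constraint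
problem that belongs to `M` has a solution whose join belongs to `M`. -/
structure IsCrossConstraintIdeal (r : ℕ) (M : Set (Set ℕ)) : Prop where
  turingIdeal : IsTuringIdeal M
  solution_mem : ∀ T : Set (CrossString r), IsCCInstance T → codeSet T ∈ M →
    ∃ P Q : CrossSeq r, IsCCSolution T P Q ∧ setJoin (seqSet P) (seqSet Q) ∈ M

end CrossConstraint

/-! ### Oracle computations depend continuously on the oracle -/

namespace OracleCode

/-! The engine is a low basis theorem for left-full classes, `exists_low_generic`. A condition is a
triple (ρ, σ, e) such that every X extending ρ has a companion Y extending σ with e outside the jump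
of (A, X, Y). By compactness in Y the failure of this is semidecidable in A, so A' can search for
conditions. At stage i either the divergence of i can be added to the condition, or some X extending
ρ defeats this. In the second case a finite part of X already defeats it, and below that part
suitable longer strings make i converge. So A' computes the jump of the limit. The limit is also
generic: if it avoids a semidecidable class, then below some ρ a left-full class avoids it.

The combinatorics play three colors on the left against two on the right. A pair (X, Y) is opposed
at s if every X₁ that starts with a given string and then differs from X everywhere has a companion
Y₁ whose s-th coloring is, past that string, opposite to that of Y. Suppose a class stays left-full
below some string after two restrictions to opposed pairs, and fix a member (X₀, Y₀). Three colors
allow an X₁ that avoids X₀ and a given X₂ at once. With two colors, a double reversal returns to the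
s-th coloring of Y₀. So all X₂ in a cone have companions whose s-th coloring is eventually one fixed
sequence (`exists_constant_of_opposite_twice`).

Therefore take a maximal set S of coordinates that can be frozen to some w on a left-full class. The
suitable w form a co-semidecidable class, so w can be chosen with (A, w) having jump computable from
A' (`exists_maximal_agreeing`). Coordinates in S are then infinitely compatible for free. By
maximality each other coordinate becomes unopposed after at most one restriction
(`exists_unopposed`). Choose (X₀, Y₀) generic in the resulting class, then (X₁, Y₁) generic over it
with X₁ avoiding X₀ past a fixed string. If the s-th colorings were eventually opposite, genericity
of the second pair would spread this to a whole cone of X₁, whereas genericity of the first pair and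
unopposedness put in every such cone an X₁ all of whose companions agree with Y₀ somewhere further
on (`exists_compatible_of_unopposed`).

Each choice keeps the jump computable from A', which gives `exists_low_solution`. Iterating it with
bookkeeping over all instances produces a chain of low sets, and the sets computable from members of
the chain form the ideal. -/

theorem mem_eval_pair {g : ℕ →. ℕ} {c d : OracleCode} {x y : ℕ} :
    y ∈ eval g (pair c d) x ↔ ∃ a ∈ eval g c x, ∃ b ∈ eval g d x, Nat.pair a b = y := by
  simp [eval, Seq.seq]

theorem mem_eval_comp {g : ℕ →. ℕ} {c d : OracleCode} {x y : ℕ} :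
    y ∈ eval g (comp c d) x ↔ ∃ a ∈ eval g d x, y ∈ eval g c a := by
  change y ∈ Part.bind (eval g d x) (fun a => eval g c a) ↔ _
  exact Part.mem_bind_iff

theorem eval_prec_zero (g : ℕ →. ℕ) (c d : OracleCode) (a : ℕ) :
    eval g (prec c d) (Nat.pair a 0) = eval g c a := by
  simp [eval]

theorem mem_eval_prec_succ {g : ℕ →. ℕ} {c d : OracleCode} {a n y : ℕ} :
    y ∈ eval g (prec c d) (Nat.pair a (n + 1)) ↔
      ∃ i ∈ eval g (prec c d) (Nat.pair a n), y ∈ eval g d (Nat.pair a (Nat.pair n i)) := by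
  simp [eval]

theorem mem_eval_rfind {g : ℕ →. ℕ} {c : OracleCode} {x y : ℕ} :
    y ∈ eval g (rfind c) x ↔ 0 ∈ eval g c (Nat.pair x y) ∧
      ∀ m < y, ∃ k, k ≠ 0 ∧ k ∈ eval g c (Nat.pair x m) := by
  refine Nat.mem_rfind.trans ?_
  simp only [Part.map_eq_map, Part.mem_map_iff]
  simp [and_comm]

theorem eval_mono {g g' : ℕ →. ℕ} (h : ∀ x, ∀ y ∈ g x, y ∈ g' x) (c : OracleCode) :
    ∀ x, ∀ y ∈ eval g c x, y ∈ eval g' c x := by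
  induction c with
  | zero | succ | left | right => exact fun x y hy => hy
  | oracle => exact h
  | pair c d ihc ihd =>
    intro x y
    simp only [mem_eval_pair]
    rintro ⟨a, ha, b, hb, e⟩
    exact ⟨a, ihc _ _ ha, b, ihd _ _ hb, e⟩
  | comp c d ihc ihd =>
    intro x y
    simp only [mem_eval_comp]
    rintro ⟨a, ha, hb⟩
    exact ⟨a, ihd _ _ ha, ihc _ _ hb⟩
  | prec c d ihc ihd =>
    intro x
    rw [← Nat.pair_unpair x]
    generalize x.unpair.1 = a
    induction x.unpair.2 with
    | zero => simpa only [eval_prec_zero] using ihc a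
    | succ n ih =>
      intro y
      simp only [mem_eval_prec_succ]
      rintro ⟨i, hi, hy⟩
      exact ⟨i, ih _ hi, ihd _ _ hy⟩
  | rfind c ihc =>
    intro x y
    simp only [mem_eval_rfind]
    rintro ⟨h0, h1⟩
    refine ⟨ihc _ _ h0, fun m hm => ?_⟩
    obtain ⟨k, hk, hk'⟩ := h1 m hm
    exact ⟨k, hk, ihc _ _ hk'⟩

theorem exists_bound_of_monotone {Q : ℕ → ℕ → Prop} (hQ : ∀ m a b, a ≤ b → Q m a → Q m b)
    (k : ℕ) (h : ∀ m < k, ∃ n, Q m n) : ∃ n, ∀ m < k, Q m n := by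
  induction k with
  | zero => exact ⟨0, by simp⟩
  | succ k ih =>
    obtain ⟨n, hn⟩ := ih fun m hm => h m (by omega)
    obtain ⟨n', hn'⟩ := h k (by omega)
    refine ⟨max n n', fun m hm => ?_⟩
    rcases Nat.lt_succ_iff_lt_or_eq.1 hm with h1 | rfl
    · exact hQ _ _ _ (le_max_left _ _) (hn m h1)
    · exact hQ _ _ _ (le_max_right _ _) hn'

/-- A halting computation asks its oracle finitely many questions. In the `rfind` case the stages
for all rejected candidates have to be bounded together. -/
theorem exists_eval_of_directed {g : ℕ →. ℕ} {G : ℕ → ℕ →. ℕ}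
    (hG : ∀ n m, n ≤ m → ∀ x, ∀ y ∈ G n x, y ∈ G m x)
    (h : ∀ x, ∀ y ∈ g x, ∃ n, y ∈ G n x) (c : OracleCode) :
    ∀ x, ∀ y ∈ eval g c x, ∃ n, y ∈ eval (G n) c x := by
  have mono : ∀ {c : OracleCode} {n m x y}, n ≤ m → y ∈ eval (G n) c x → y ∈ eval (G m) c x :=
    fun hnm hy => eval_mono (hG _ _ hnm) _ _ _ hy
  induction c with
  | zero | succ | left | right => exact fun x y hy => ⟨0, hy⟩
  | oracle => exact h
  | pair c d ihc ihd =>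
    intro x y
    simp only [mem_eval_pair]
    rintro ⟨a, ha, b, hb, e⟩
    obtain ⟨n, hn⟩ := ihc _ _ ha
    obtain ⟨m, hm⟩ := ihd _ _ hb
    exact ⟨max n m, a, mono (le_max_left _ _) hn, b, mono (le_max_right _ _) hm, e⟩
  | comp c d ihc ihd =>
    intro x y
    simp only [mem_eval_comp]
    rintro ⟨a, ha, hb⟩
    obtain ⟨n, hn⟩ := ihd _ _ ha
    obtain ⟨m, hm⟩ := ihc _ _ hb
    exact ⟨max n m, a, mono (le_max_left _ _) hn, mono (le_max_right _ _) hm⟩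
  | prec c d ihc ihd =>
    intro x
    rw [← Nat.pair_unpair x]
    generalize x.unpair.1 = a
    induction x.unpair.2 with
    | zero => simpa only [eval_prec_zero] using ihc a
    | succ k ih =>
      intro y
      simp only [mem_eval_prec_succ]
      rintro ⟨i, hi, hy⟩
      obtain ⟨n, hn⟩ := ih _ hi
      obtain ⟨m, hm⟩ := ihd _ _ hy
      exact ⟨max n m, i, mono (le_max_left _ _) hn, mono (le_max_right _ _) hm⟩
  | rfind c ihc =>
    intro x y
    simp only [mem_eval_rfind]
    rintro ⟨h0, h1⟩
    obtain ⟨n, hn⟩ := ihc _ _ h0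
    obtain ⟨m, hm⟩ := exists_bound_of_monotone
      (Q := fun m n => ∃ k, k ≠ 0 ∧ k ∈ eval (G n) c (Nat.pair x m))
      (fun m a b hab ⟨k, hk, hk'⟩ => ⟨k, hk, mono hab hk'⟩) y
      (fun m hm => by
        obtain ⟨k, hk, hk'⟩ := h1 m hm
        obtain ⟨n, hn⟩ := ihc _ _ hk'
        exact ⟨n, k, hk, hn⟩)
    refine ⟨max n m, mono (le_max_left _ _) hn, fun j hj => ?_⟩
    obtain ⟨k, hk, hk'⟩ := hm j hj
    exact ⟨k, hk, mono (le_max_right _ _) hk'⟩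

/-- The partial oracle given by a finite string of answers. -/
def stringOracle (l : List Bool) : ℕ →. ℕ := fun n => ((l[n]?).map Bool.toNat : Option ℕ)

theorem mem_stringOracle {l : List Bool} {x y : ℕ} :
    y ∈ stringOracle l x ↔ ∃ b, l[x]? = some b ∧ b.toNat = y := by
  simp [stringOracle]

theorem initSeg_getElem? {α : Type} (X : ℕ → α) (n i : ℕ) :
    (initSeg X n)[i]? = if i < n then some (X i) else none := by
  simp only [initSeg, List.getElem?_map]
  split_ifs with h
  · simp [h]
  · simp [not_lt.1 h]

/-- The use principle. It reduces computations with a set as oracle to computations with finite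
strings, which an ordinary universal machine can run. -/
theorem mem_eval_charFun_iff (B : Set ℕ) (X : ℕ → Bool) (hX : ∀ n, X n = true ↔ n ∈ B)
    (c : OracleCode) (x y : ℕ) :
    y ∈ eval (charFun B) c x ↔ ∃ n, y ∈ eval (stringOracle (initSeg X n)) c x := by
  have key : ∀ n : ℕ, ∀ y, y ∈ charFun B n ↔ (X n).toNat = y := by
    intro n y
    have := hX n
    by_cases h : n ∈ B
    · have h' : X n = true := this.2 h
      simp [charFun, h, h', eq_comm]
    · have h' : X n = false := by simpa [h] using this
      simp [charFun, h, h', eq_comm]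
  constructor
  · refine exists_eval_of_directed ?_ ?_ c x y
    · intro n m hnm x y
      simp only [mem_stringOracle, initSeg_getElem?]
      rintro ⟨b, hb, rfl⟩
      split_ifs at hb with h
      exact ⟨b, by rwa [if_pos (by omega)], rfl⟩
    · intro x y hy
      refine ⟨x + 1, ?_⟩
      simp only [mem_stringOracle, initSeg_getElem?]
      exact ⟨X x, by simp, (key _ _).1 hy⟩
  · rintro ⟨n, hn⟩
    refine eval_mono ?_ c x y hn
    intro x y
    simp only [mem_stringOracle, initSeg_getElem?]
    rintro ⟨b, hb, rfl⟩
    split_ifs at hb with h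
    rw [key]
    simpa using congrArg Bool.toNat (Option.some.inj hb)

/-! ### A universal machine for computations with a finite oracle -/

open Nat.Partrec (Code)

/-- Rearranges `(t, (a, n))` to `((t, a), n)`. -/
def assocLeft : Code :=
  .pair (.pair .left (.comp .left .right)) (.comp .right .right)

/-- Rearranges `((t, a), n)` to `(t, (a, n))`. -/
def assocRight : Code :=
  .pair (.comp .left .left) (.pair (.comp .right .left) .right)

theorem code_eval_comp (c d : Code) (x : ℕ) :
    (Code.comp c d).eval x = (d.eval x).bind fun a => c.eval a := rfl

theorem code_eval_left (x : ℕ) : Code.left.eval x = Part.some x.unpair.1 := rfl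

theorem code_eval_right (x : ℕ) : Code.right.eval x = Part.some x.unpair.2 := rfl

theorem code_eval_succ (x : ℕ) : Code.succ.eval x = Part.some (x + 1) := rfl

theorem code_eval_pair (c d : Code) (x : ℕ) :
    (Code.pair c d).eval x = (c.eval x).bind fun a => (d.eval x).map (Nat.pair a) := by
  simp [Code.eval, Seq.seq]

theorem eval_assocLeft (t a n : ℕ) :
    assocLeft.eval (Nat.pair t (Nat.pair a n)) = Part.some (Nat.pair (Nat.pair t a) n) := by
  simp [assocLeft, code_eval_comp, code_eval_pair, code_eval_left, code_eval_right]

theorem eval_assocRight (t a n : ℕ) :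
    assocRight.eval (Nat.pair (Nat.pair t a) n) = Part.some (Nat.pair t (Nat.pair a n)) := by
  simp [assocRight, code_eval_comp, code_eval_pair, code_eval_left, code_eval_right]

/-- Translation of oracle programs to ordinary programs which receive the oracle, a finite
string coded by the number `t`, in the input `(t, x)`; `L` is a program for looking up answers. -/
def toCode (L : Code) : OracleCode → Code
  | zero => .zero
  | succ => .comp .succ .right
  | left => .comp .left .right
  | right => .comp .right .right
  | oracle => L
  | pair c d => .pair (toCode L c) (toCode L d)
  | comp c d => .comp (toCode L c) (.pair .left (toCode L d))
  | prec c d => .comp (.prec (toCode L c) (.comp (toCode L d) assocRight)) assocLeft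
  | rfind c => .comp (.rfind' (.comp (toCode L c) assocRight)) (.pair Code.id .zero)

theorem eval_toCode {L : Code} {g : ℕ →. ℕ} {t : ℕ} (hL : ∀ n, L.eval (Nat.pair t n) = g n)
    (c : OracleCode) : ∀ x, (toCode L c).eval (Nat.pair t x) = eval g c x := by
  induction c with
  | zero => intro x; rfl
  | succ | left | right => 
    intro x
    simp [toCode, code_eval_succ, code_eval_comp, code_eval_left, code_eval_right, eval]
  | oracle => exact hL
  | pair c d ihc ihd => intro x; simp [toCode, Code.eval, eval, ihc, ihd]
  | comp c d ihc ihd =>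
    intro x
    rw [toCode, code_eval_comp, code_eval_pair, ihd, code_eval_left]
    ext y
    simp [mem_eval_comp, ihc]
  | prec c d ihc ihd =>
    intro x
    rw [← Nat.pair_unpair x]
    generalize x.unpair.1 = a
    have h1 : ∀ n, (toCode L (prec c d)).eval (Nat.pair t (Nat.pair a n)) =
        (Code.prec (toCode L c) (.comp (toCode L d) assocRight)).eval
          (Nat.pair (Nat.pair t a) n) := by
      intro n
      rw [toCode, code_eval_comp, eval_assocLeft, Part.bind_some]
    rw [h1]
    induction x.unpair.2 with
    | zero => rw [Code.eval_prec_zero, eval_prec_zero, ihc]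
    | succ n ih =>
      rw [Code.eval_prec_succ, ih]
      ext y
      rw [mem_eval_prec_succ]
      simp only [code_eval_comp, eval_assocRight, Part.bind_eq_bind, Part.mem_bind_iff,
        Part.bind_some, ihd]
  | rfind c ihc =>
    intro x
    -- `rfind'` starts its search at the second component of its input, so pairing with 0 turns it
    -- into an ordinary search.
    have h1 : (Code.pair Code.id .zero).eval (Nat.pair t x) =
        Part.some (Nat.pair (Nat.pair t x) 0) := by
      simp [Code.eval, Seq.seq, Code.eval_id, pure, PFun.pure]
    have h2 : ∀ n, (Code.comp (toCode L c) assocRight).eval (Nat.pair (Nat.pair t x) n) =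
        eval g c (Nat.pair x n) := fun n => by
      rw [code_eval_comp, eval_assocRight, Part.bind_some, ihc]
    rw [toCode, code_eval_comp, h1, Part.bind_some]
    simp only [Code.eval.eq_8, Nat.unpaired, Nat.unpair_pair, add_zero, h2, eval]
    exact Part.map_id' (fun _ => rfl) _

/-- The program with a given Gödel number. -/
noncomputable def ofIndex : ℕ → OracleCode := (Equiv.ofBijective index index_bijective).symm

theorem index_ofIndex (n : ℕ) : (ofIndex n).index = n :=
  (Equiv.ofBijective index index_bijective).apply_symm_apply n

theorem ofIndex_index (c : OracleCode) : ofIndex c.index = c :=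
  (Equiv.ofBijective index index_bijective).symm_apply_apply c

/-- Course-of-values recursion on Gödel numbers: the list `l` holds the translations of all smaller
numbers, its length n is the current number, and (n - 5) % 4 and (n - 5) / 4 recover the constructor
and its arguments. -/
theorem primrec_toCode_ofIndex (L : Code) : Primrec fun n => toCode L (ofIndex n) := by
  let G : List Code → Option Code := fun l =>
    let n := l.length
    let m := (n - 5) / 4
    if n = 0 then some .zero
    else if n = 1 then some (.comp .succ .right)
    else if n = 2 then some (.comp .left .right)
    else if n = 3 then some (.comp .right .right)
    else if n = 4 then some L
    else if (n - 5) % 4 = 0 then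
      l[m.unpair.1]?.bind fun c => l[m.unpair.2]?.map fun d => .pair c d
    else if (n - 5) % 4 = 1 then
      l[m.unpair.1]?.bind fun c => l[m.unpair.2]?.map fun d => .comp c (.pair .left d)
    else if (n - 5) % 4 = 2 then
      l[m.unpair.1]?.bind fun c => l[m.unpair.2]?.map fun d =>
        .comp (.prec c (.comp d assocRight)) assocLeft
    else l[m]?.map fun c => .comp (.rfind' (.comp c assocRight)) (.pair Code.id .zero)
  have hn : Primrec fun l : List Code => l.length := Primrec.list_length
  have hk : Primrec fun l : List Code => l.length - 5 := Primrec.nat_sub.comp hn (.const 5)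
  have hm : Primrec fun l : List Code => (l.length - 5) / 4 := Primrec.nat_div.comp hk (.const 4)
  have hr : Primrec fun l : List Code => (l.length - 5) % 4 := Primrec.nat_mod.comp hk (.const 4)
  have h1 : Primrec fun l : List Code => l[((l.length - 5) / 4).unpair.1]? :=
    Primrec.list_getElem?.comp .id (Primrec.fst.comp (Primrec.unpair.comp hm))
  have h2 : Primrec fun l : List Code => l[((l.length - 5) / 4).unpair.2]? :=
    Primrec.list_getElem?.comp .id (Primrec.snd.comp (Primrec.unpair.comp hm))
  have h3 : Primrec fun l : List Code => l[(l.length - 5) / 4]? :=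
    Primrec.list_getElem?.comp .id hm
  have hbin : ∀ {F : Code → Code → Code}, Primrec₂ F → Primrec fun l : List Code =>
      l[((l.length - 5) / 4).unpair.1]?.bind fun c =>
        l[((l.length - 5) / 4).unpair.2]?.map fun d => F c d := by
    intro F hF
    refine Primrec.option_bind h1 ?_
    have h4 : Primrec fun p : List Code × Code =>
        p.1[((p.1.length - 5) / 4).unpair.2]?.map fun d => F p.2 d :=
      Primrec.option_map (h2.comp Primrec.fst)
        (hF.comp (Primrec.snd.comp Primrec.fst) Primrec.snd).to₂
    exact h4.to₂
  have hG : Primrec G := by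
    have hc' : ∀ F : Code, Primrec fun _ : List Code => some F := fun F => .const _
    have heq : ∀ k : ℕ, PrimrecPred fun l : List Code => l.length = k :=
      fun k => Primrec.eq.comp hn (.const k)
    have heq' : ∀ k : ℕ, PrimrecPred fun l : List Code => (l.length - 5) % 4 = k :=
      fun k => Primrec.eq.comp hr (.const k)
    refine .ite (heq 0) (hc' _) <| .ite (heq 1) (hc' _) <| .ite (heq 2) (hc' _) <|
      .ite (heq 3) (hc' _) <| .ite (heq 4) (hc' _) <| .ite (heq' 0) (hbin ?_) <|
      .ite (heq' 1) (hbin ?_) <| .ite (heq' 2) (hbin ?_) (.option_map h3 ?_)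
    · exact Code.primrec₂_pair
    · exact Code.primrec₂_comp.comp .fst (Code.primrec₂_pair.comp (.const _) .snd)
    · exact Code.primrec₂_comp.comp (Code.primrec₂_prec.comp .fst
        (Code.primrec₂_comp.comp .snd (.const _))) (.const _)
    · exact (Code.primrec₂_comp.comp (Code.primrec_rfind'.comp
        (Code.primrec₂_comp.comp .snd (.const _))) (.const _)).to₂
  have key : Primrec₂ fun (_ : Unit) n => toCode L (ofIndex n) := by
    refine Primrec.nat_strong_rec _ (g := fun _ l => G l) (hG.comp Primrec.snd) ?_
    intro _ n
    obtain ⟨c, rfl⟩ := index_bijective.2 n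
    have hlen : ∀ k, ((List.range k).map fun n => toCode L (ofIndex n)).length = k := by simp
    have hget : ∀ (k : ℕ) (d : OracleCode), d.index < k →
        ((List.range k).map fun n => toCode L (ofIndex n))[d.index]? = some (toCode L d) := by
      intro k d h
      simp [h, ofIndex_index]
    rw [ofIndex_index]
    cases c with
    | zero | succ | left | right | oracle => simp [G, index, toCode]
    | pair c d | comp c d | prec c d =>
      have hc := Nat.left_le_pair c.index d.index
      have hd := Nat.right_le_pair c.index d.index
      simp only [G, hlen]
      simp only [index]
      have e1 : ∀ j < 4, (4 * Nat.pair c.index d.index + (5 + j) - 5) % 4 = j := by omega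
      have e2 : ∀ j < 4, (4 * Nat.pair c.index d.index + (5 + j) - 5) / 4 =
        Nat.pair c.index d.index := by omega
      have e1' := e1 0 (by omega)
      have e2' := e2 0 (by omega)
      have e11 := e1 1 (by omega)
      have e21 := e2 1 (by omega)
      have e12 := e1 2 (by omega)
      have e22 := e2 2 (by omega)
      simp only [Nat.reduceAdd, add_zero] at e1' e2' e11 e21 e12 e22
      simp only [e1', e2', e11, e21, e12, e22, Nat.unpair_pair]
      rw [hget _ c (by omega), hget _ d (by omega)]
      simp [toCode]
    | rfind c =>
      simp only [G, hlen]
      simp only [index]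
      have e1 : (4 * c.index + 8 - 5) % 4 = 3 := by omega
      have e2 : (4 * c.index + 8 - 5) / 4 = c.index := by omega
      simp only [e1, e2]
      rw [hget _ c (by omega)]
      simp [toCode]
  exact key.comp (.const ()) .id

end OracleCode

/-! ### Initial segments -/

section InitSeg

variable {α β γ : Type}

@[simp]
theorem length_initSeg (X : ℕ → α) (n : ℕ) : (initSeg X n).length = n := by simp [initSeg]

theorem initSeg_eq_iff {X Y : ℕ → α} {n : ℕ} :
    initSeg X n = initSeg Y n ↔ ∀ i < n, X i = Y i := by
  simp [initSeg]

theorem take_initSeg (X : ℕ → α) {k n : ℕ} (h : k ≤ n) : (initSeg X n).take k = initSeg X k := by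
  simp [initSeg, ← List.map_take, List.take_range, h]

theorem initSeg_prefix (X : ℕ → α) {k n : ℕ} (h : k ≤ n) : initSeg X k <+: initSeg X n := by
  rw [← take_initSeg X h]
  exact List.take_prefix _ _

/-- The sequence `X` has the initial segment `ρ`. -/
def Extends (ρ : List α) (X : ℕ → α) : Prop := initSeg X ρ.length = ρ

theorem extends_initSeg (X : ℕ → α) (n : ℕ) : Extends (initSeg X n) X := by simp [Extends]

@[simp]
theorem extends_nil (X : ℕ → α) : Extends [] X := rfl

theorem extends_initSeg_iff {X Y : ℕ → α} {n : ℕ} :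
    Extends (initSeg X n) Y ↔ ∀ i < n, Y i = X i := by
  simp [Extends, initSeg_eq_iff]

theorem Extends.of_prefix {ρ ρ' : List α} {X : ℕ → α} (h : ρ <+: ρ') (hX : Extends ρ' X) :
    Extends ρ X := by
  unfold Extends at *
  rw [← take_initSeg X h.length_le, hX]
  exact (List.prefix_iff_eq_take.1 h).symm

theorem Extends.prefix_initSeg {ρ : List α} {X : ℕ → α} (hX : Extends ρ X) {n : ℕ}
    (h : ρ.length ≤ n) : ρ <+: initSeg X n := by
  have := initSeg_prefix X h
  rwa [hX] at this

theorem Extends.of_initSeg_eq {ρ : List α} {X Y : ℕ → α} (hX : Extends ρ X) {n : ℕ}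
    (h : ρ.length ≤ n) (hXY : ∀ i < n, Y i = X i) : Extends ρ Y :=
  .of_prefix (hX.prefix_initSeg h) (extends_initSeg_iff.2 hXY)

theorem exists_extends [Inhabited α] (ρ : List α) : ∃ X, Extends ρ X := by
  refine ⟨fun i => ρ.getD i default, List.ext_getElem (by simp) fun i h1 h2 => ?_⟩
  simp [initSeg, h2]

/-- The list of pairs of entries of two lists. -/
def pairLists (l : List α) (m : List β) : List (α × β) :=
  (List.range l.length).filterMap fun i => l[i]?.bind fun a => m[i]?.map fun b => (a, b)

theorem pairLists_initSeg (X : ℕ → α) (Y : ℕ → β) (n : ℕ) :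
    pairLists (initSeg X n) (initSeg Y n) = initSeg (fun i => (X i, Y i)) n := by
  simp only [pairLists, length_initSeg, OracleCode.initSeg_getElem?]
  rw [initSeg, ← List.filterMap_eq_map]
  refine List.filterMap_congr fun i hi => ?_
  rw [List.mem_range] at hi
  simp [hi]

theorem primrec_pairLists [Primcodable α] [Primcodable β] : Primrec₂ (@pairLists α β) := by
  refine Primrec.listFilterMap (Primrec.list_range.comp (Primrec.list_length.comp .fst)) ?_
  refine Primrec.option_bind (Primrec.list_getElem?.comp (Primrec.fst.comp .fst) .snd) ?_
  have h : Primrec fun p : ((List α × List β) × ℕ) × α => p.1.1.2[p.1.2]? :=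
    Primrec.list_getElem?.comp (Primrec.snd.comp (Primrec.fst.comp .fst))
      (Primrec.snd.comp .fst)
  have h2 : Primrec fun p : ((List α × List β) × ℕ) × α => p.1.1.2[p.1.2]?.map fun b => (p.2, b) :=
    Primrec.option_map h ((Primrec.snd.comp .fst).pair .snd).to₂
  exact h2.to₂

/-- The list of all strings of length `n` with entries in `u`. -/
def stringsOfLength (u : List α) : ℕ → List (List α)
  | 0 => [[]]
  | n + 1 => (stringsOfLength u n).flatMap fun l => u.map fun a => a :: l

theorem mem_stringsOfLength {u : List α} (hu : ∀ a, a ∈ u) (n : ℕ) (l : List α) :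
    l ∈ stringsOfLength u n ↔ l.length = n := by
  induction n generalizing l with
  | zero => simp [stringsOfLength]
  | succ n ih =>
    cases l <;> simp [stringsOfLength, ih, hu]

theorem primrec_stringsOfLength [Primcodable α] (u : List α) : Primrec (stringsOfLength u) := by
  have hg : Primrec₂ fun (_ : ℕ) (L : List (List α)) =>
      L.flatMap fun l => u.map fun a => a :: l := by
    refine Primrec.list_flatMap .snd ?_
    refine Primrec.list_map (.const u) ?_
    exact (Primrec.list_cons.comp .snd (Primrec.snd.comp .fst)).to₂
  refine (Primrec.nat_rec₁ [[]] hg).of_eq fun n => ?_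
  induction n with
  | zero => rfl
  | succ n ih => simp only [stringsOfLength, ← ih]

theorem primrecRel_prefix [Primcodable α] : PrimrecRel (fun l m : List α => l <+: m) := by
  have : PrimrecRel fun l m : List α => l = m.take l.length :=
    Primrec.eq.comp .fst (Primrec.list_take.comp (Primrec.list_length.comp .fst) .snd)
  exact this.of_eq fun l m => List.prefix_iff_eq_take.symm

/-- A monotone property of strings which holds somewhere along every sequence extending `σ` over
a finite alphabet holds at a uniform level. -/
theorem exists_uniform_level [Finite β] {S : List β → Prop}
    (hS : ∀ l l', l <+: l' → S l → S l') {σ : List β}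
    (h : ∀ Y, Extends σ Y → ∃ n, S (initSeg Y n)) :
    ∃ n, ∀ Y, Extends σ Y → S (initSeg Y n) := by
  by_contra! hcon
  let _ : TopologicalSpace β := ⊥
  have _ : DiscreteTopology β := ⟨rfl⟩
  -- The counterexamples at level n form a decreasing sequence of nonempty closed subsets of a
  -- compact space; a common point contradicts the hypothesis.
  let K : ℕ → Set (ℕ → β) := fun n => {Y | Extends σ Y ∧ ¬ S (initSeg Y n)}
  have hclosed : ∀ n, IsClosed (K n) := by
    intro n
    rw [← isOpen_compl_iff, isOpen_iff_forall_mem_open]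
    intro Y hY
    refine ⟨⋂ i ∈ Finset.range (max n σ.length), {Z : ℕ → β | Z i = Y i}, ?_, ?_, by simp⟩
    · intro Z hZ hZK
      simp only [Set.mem_iInter, Finset.mem_range, Set.mem_ofPred_eq] at hZ
      refine hY ⟨hZK.1.of_initSeg_eq (le_max_right n _) fun i hi => (hZ i hi).symm, ?_⟩
      rw [← initSeg_eq_iff.2 fun i hi => hZ i (lt_max_of_lt_left hi)]
      exact hZK.2
    · refine isOpen_biInter_finset fun i _ => ?_
      exact (continuous_apply (A := fun _ : ℕ => β) i).isOpen_preimage {Y i} (isOpen_discrete _)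
  obtain ⟨Y, hY⟩ := IsCompact.nonempty_iInter_of_sequence_nonempty_isCompact_isClosed K
    (fun n Y hY => ⟨hY.1, fun h => hY.2 (hS _ _ (initSeg_prefix Y n.le_succ) h)⟩)
    (fun n => hcon n) (hclosed 0).isCompact hclosed
  rw [Set.mem_iInter] at hY
  obtain ⟨n, hn⟩ := h Y (hY 0).1
  exact (hY n).2 hn

theorem rel_initSeg_mono {ι : Type} {R : List γ → ι → Prop} (hR : ∀ l l' b, l <+: l' → R l b → R l' b)
    {Z : ℕ → γ} {b : ι} {n m : ℕ} (hnm : n ≤ m) (h : R (initSeg Z n) b) : R (initSeg Z m) b :=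
  hR _ _ _ (initSeg_prefix Z hnm) h

/-- The join of three sequences. -/
def joinSeq (A : ℕ → γ) (X : ℕ → α) (Y : ℕ → β) : ℕ → γ × α × β := fun n => (A n, X n, Y n)

theorem joinSeq_initSeg (A : ℕ → γ) (X : ℕ → α) (Y : ℕ → β) (n : ℕ) :
    initSeg (joinSeq A X Y) n =
      pairLists (initSeg A n) (pairLists (initSeg X n) (initSeg Y n)) := by
  rw [pairLists_initSeg, pairLists_initSeg]
  rfl

/-- With A and X fixed, the segment of the join depends only on the segment of Y, so compactness in
Y alone suffices; γ and α may be infinite. -/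
theorem exists_uniform_level_join [Finite β] [Inhabited β] {R : List (γ × α × β) → Prop}
    (hR : ∀ l l', l <+: l' → R l → R l') {A : ℕ → γ} {X : ℕ → α} {σ : List β}
    (h : ∀ Y, Extends σ Y → ∃ n, R (initSeg (joinSeq A X Y) n)) :
    ∃ n, ∀ Y, Extends σ Y → R (initSeg (joinSeq A X Y) n) := by
  simp only [joinSeq_initSeg] at h ⊢
  have key := exists_uniform_level (σ := σ)
    (S := fun l => R (pairLists (initSeg A l.length) (pairLists (initSeg X l.length) l)))
    (by
      intro l l' hl h
      obtain ⟨Y, hY⟩ := exists_extends l'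
      have e1 := hY.of_prefix hl
      rw [← e1] at h
      rw [← hY]
      simp only [length_initSeg, ← joinSeq_initSeg] at h ⊢
      exact hR _ _ (initSeg_prefix _ hl.length_le) h)
    (by simpa using h)
  simpa using key

end InitSeg

/-! ### Semidecidable predicates of sequences -/

section Semidec

variable {α β γ δ ι κ : Type} [Primcodable α] [Primcodable β] [Primcodable γ] [Primcodable δ]
  [Primcodable ι] [Primcodable κ]

/-- `P Z b` is semidecidable with oracle `Z`, uniformly in the sequence `Z` and in `b`. -/
def IsSemidec (P : (ℕ → γ) → ι → Prop) : Prop :=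
  ∃ R : List γ → ι → Prop, PrimrecRel R ∧ ∀ Z b, P Z b ↔ ∃ n, R (initSeg Z n) b

theorem PrimrecPred.exists_mem_list' {f : ι → List κ} {R : κ → ι → Prop} (hf : Primrec f)
    (hR : PrimrecRel R) : PrimrecPred fun b => ∃ a ∈ f b, R a b :=
  hR.exists_mem_list.comp hf .id

theorem PrimrecPred.forall_mem_list' {f : ι → List κ} {R : κ → ι → Prop} (hf : Primrec f)
    (hR : PrimrecRel R) : PrimrecPred fun b => ∀ a ∈ f b, R a b :=
  hR.forall_mem_list.comp hf .id

namespace IsSemidec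

theorem of_iff {P Q : (ℕ → γ) → ι → Prop} (hP : IsSemidec P) (h : ∀ Z b, Q Z b ↔ P Z b) :
    IsSemidec Q := by
  obtain ⟨R, hR, hP⟩ := hP
  exact ⟨R, hR, fun Z b => (h Z b).trans (hP Z b)⟩

/-- Accepting a string when some prefix of it was accepted makes the witness monotone, so that
finitely many stages can be replaced by their maximum. -/
theorem exists_mono {P : (ℕ → γ) → ι → Prop} (hP : IsSemidec P) :
    ∃ R : List γ → ι → Prop, PrimrecRel R ∧ (∀ l l' b, l <+: l' → R l b → R l' b) ∧
      ∀ Z b, P Z b ↔ ∃ n, R (initSeg Z n) b := by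
  obtain ⟨R, hR, hP⟩ := hP
  refine ⟨fun l b => ∃ k ∈ List.range (l.length + 1), R (l.take k) b, ?_, ?_, fun Z b => ?_⟩
  · refine PrimrecPred.exists_mem_list' (ι := List γ × ι)
      (R := fun k p => R (p.1.take k) p.2) (f := fun p => List.range (p.1.length + 1)) ?_ ?_
    · exact Primrec.list_range.comp (Primrec.succ.comp (Primrec.list_length.comp .fst))
    · exact hR.comp (Primrec.list_take.comp .fst (Primrec.fst.comp .snd))
        (Primrec.snd.comp .snd)
  · rintro l l' b h ⟨k, hk, hR⟩
    simp only [List.mem_range] at hk ⊢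
    have hl := h.length_le
    refine ⟨k, by omega, ?_⟩
    have : l'.take k = l.take k := by
      rw [List.prefix_iff_eq_take.1 h, List.take_take, min_eq_left (by omega)]
    rwa [this]
  · rw [hP]
    constructor
    · rintro ⟨n, hn⟩
      exact ⟨n, n, by simp, by rwa [take_initSeg _ le_rfl]⟩
    · rintro ⟨n, k, hk, hR⟩
      simp only [length_initSeg, List.mem_range] at hk
      rw [take_initSeg _ (by omega)] at hR
      exact ⟨k, hR⟩

theorem and {P Q : (ℕ → γ) → ι → Prop} (hP : IsSemidec P) (hQ : IsSemidec Q) :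
    IsSemidec fun Z b => P Z b ∧ Q Z b := by
  obtain ⟨R, hR, hm, hP⟩ := hP.exists_mono
  obtain ⟨S, hS, hm', hQ⟩ := hQ.exists_mono
  refine ⟨fun l b => R l b ∧ S l b, PrimrecPred.and hR hS, fun Z b => ?_⟩
  simp only [hP, hQ]
  constructor
  · rintro ⟨⟨n, hn⟩, m, hm''⟩
    exact ⟨max n m, rel_initSeg_mono hm (le_max_left _ _) hn, rel_initSeg_mono hm' (le_max_right _ _) hm''⟩
  · rintro ⟨n, h1, h2⟩
    exact ⟨⟨n, h1⟩, n, h2⟩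

theorem or {P Q : (ℕ → γ) → ι → Prop} (hP : IsSemidec P) (hQ : IsSemidec Q) :
    IsSemidec fun Z b => P Z b ∨ Q Z b := by
  obtain ⟨R, hR, hP⟩ := hP
  obtain ⟨S, hS, hQ⟩ := hQ
  refine ⟨fun l b => R l b ∨ S l b, PrimrecPred.or hR hS, fun Z b => ?_⟩
  simp only [hP, hQ, exists_or]

theorem comp {P : (ℕ → γ) → ι → Prop} (hP : IsSemidec P) {f : κ → ι} (hf : Primrec f) :
    IsSemidec fun Z b => P Z (f b) := by
  obtain ⟨R, hR, hP⟩ := hP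
  exact ⟨fun l b => R l (f b), hR.comp .fst (hf.comp .snd), fun Z b => hP Z _⟩

theorem of_primrecPred {p : ι → Prop} (hp : PrimrecPred p) :
    IsSemidec fun (_ : ℕ → γ) b => p b :=
  ⟨fun _ b => p b, hp.comp .snd, fun Z b => by simp⟩

/-- Change of oracle along an operator that maps initial segments primitive recursively to
initial segments of the same length. -/
theorem comp_oracle {P : (ℕ → δ) → ι → Prop} (hP : IsSemidec P) {F : (ℕ → γ) → (ℕ → δ)}
    {φ : List γ → List δ} (hφ : Primrec φ) (hF : ∀ Z n, initSeg (F Z) n = φ (initSeg Z n)) :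
    IsSemidec fun Z b => P (F Z) b := by
  obtain ⟨R, hR, hP⟩ := hP
  refine ⟨fun l b => R (φ l) b, hR.comp (hφ.comp .fst) .snd, fun Z b => ?_⟩
  simp only [hP, hF]

theorem comp_pointwise {P : (ℕ → δ) → ι → Prop} (hP : IsSemidec P) {f : ℕ → γ → δ}
    (hf : Primrec₂ f) : IsSemidec fun Z b => P (fun n => f n (Z n)) b := by
  refine hP.comp_oracle (F := fun Z n => f n (Z n))
    (φ := fun l => (List.range l.length).filterMap fun i => l[i]?.map (f i)) ?_ fun Z n => ?_
  · refine Primrec.listFilterMap (Primrec.list_range.comp Primrec.list_length) ?_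
    exact Primrec.option_map (Primrec.list_getElem?.comp .fst .snd)
      (hf.comp (Primrec.snd.comp .fst) .snd).to₂
  · simp only [length_initSeg, OracleCode.initSeg_getElem?]
    rw [initSeg, ← List.filterMap_eq_map]
    refine List.filterMap_congr fun i hi => ?_
    rw [List.mem_range] at hi
    simp [hi]

/-- Dovetailing: at stage n only parameters with code below n are tried. -/
theorem exists_param {P : (ℕ → γ) → κ × ι → Prop} (hP : IsSemidec P) :
    IsSemidec fun Z b => ∃ k, P Z (k, b) := by
  obtain ⟨R, hR, hm, hP⟩ := hP.exists_mono
  refine ⟨fun l b => ∃ k ∈ (List.range l.length).filterMap fun i => (Encodable.decode i : Option κ),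
    R l (k, b), ?_, fun Z b => ?_⟩
  · refine PrimrecPred.exists_mem_list' (ι := List γ × ι) (R := fun k p => R p.1 (k, p.2))
      (f := fun p => (List.range p.1.length).filterMap fun i => (Encodable.decode i : Option κ))
      ?_ ?_
    · exact Primrec.listFilterMap (Primrec.list_range.comp (Primrec.list_length.comp .fst))
        (Primrec.decode.comp .snd).to₂
    · exact hR.comp (Primrec.fst.comp .snd) (Primrec.fst.pair (Primrec.snd.comp .snd))
  · simp only [hP]
    constructor
    · rintro ⟨k, n, hn⟩
      refine ⟨max n (Encodable.encode k + 1), k, ?_, rel_initSeg_mono hm (le_max_left _ _) hn⟩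
      simp only [length_initSeg, List.mem_filterMap, List.mem_range]
      exact ⟨Encodable.encode k, by omega, Encodable.encodek k⟩
    · rintro ⟨n, k, -, h⟩
      exact ⟨k, n, h⟩

end IsSemidec

/-- By compactness, a semidecidable predicate remains semidecidable after a universal quantifier
over sequences in a finite alphabet preceded by an existential one. -/
theorem IsSemidec.exists_forall_extends [Finite α] [Finite β] [Inhabited α] [Inhabited β]
    {P : (ℕ → γ × α × β) → ι → Prop} (hP : IsSemidec P) :
    IsSemidec fun A (b : ι × List α × List β) =>
      ∃ X, Extends b.2.1 X ∧ ∀ Y, Extends b.2.2 Y → P (joinSeq A X Y) b.1 := by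
  obtain ⟨R, hR, hm, hP⟩ := hP.exists_mono
  obtain ⟨u, hu⟩ : ∃ u : List α, ∀ a, a ∈ u := by
    have := Fintype.ofFinite α
    exact ⟨Finset.univ.toList, by simp⟩
  obtain ⟨v, hv⟩ : ∃ v : List β, ∀ a, a ∈ v := by
    have := Fintype.ofFinite β
    exact ⟨Finset.univ.toList, by simp⟩
  -- The finite form of the statement at the level |l|. The bound on the length of `b.2.2` matters:
  -- without it no σ of length |l| need extend `b.2.2`, and the universal clause would hold
  -- vacuously.
  refine ⟨fun l b => b.2.2.length ≤ l.length ∧ ∃ ρ ∈ stringsOfLength u l.length, b.2.1 <+: ρ ∧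
    ∀ σ ∈ stringsOfLength v l.length, b.2.2 <+: σ → R (pairLists l (pairLists ρ σ)) b.1,
    ?_, fun A b => ?_⟩
  · refine PrimrecPred.and (Primrec.nat_le.comp
      (Primrec.list_length.comp (Primrec.snd.comp (Primrec.snd.comp .snd)))
      (Primrec.list_length.comp .fst)) ?_
    refine PrimrecPred.exists_mem_list' (ι := List γ × ι × List α × List β)
      (R := fun ρ p => p.2.2.1 <+: ρ ∧ ∀ σ ∈ stringsOfLength v p.1.length, p.2.2.2 <+: σ →
        R (pairLists p.1 (pairLists ρ σ)) p.2.1)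
      (f := fun p => stringsOfLength u p.1.length)
      ((primrec_stringsOfLength u).comp (Primrec.list_length.comp .fst)) ?_
    refine PrimrecPred.and (primrecRel_prefix.comp
      (Primrec.fst.comp (Primrec.snd.comp (Primrec.snd.comp .snd))) .fst) ?_
    refine PrimrecPred.forall_mem_list' (ι := List α × List γ × ι × List α × List β)
      (R := fun σ p => p.2.2.2.2 <+: σ → R (pairLists p.2.1 (pairLists p.1 σ)) p.2.2.1)
      (f := fun p => stringsOfLength v p.2.1.length)
      ((primrec_stringsOfLength v).comp
        (Primrec.list_length.comp (Primrec.fst.comp .snd))) ?_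
    have h1 : PrimrecPred fun q : List β × List α × List γ × ι × List α × List β =>
        ¬ q.2.2.2.2.2 <+: q.1 := PrimrecPred.not (primrecRel_prefix.comp
      (Primrec.snd.comp (Primrec.snd.comp (Primrec.snd.comp (Primrec.snd.comp .snd)))) .fst)
    have h2 : PrimrecPred fun q : List β × List α × List γ × ι × List α × List β =>
        R (pairLists q.2.2.1 (pairLists q.2.1 q.1)) q.2.2.2.1 :=
      hR.comp (primrec_pairLists.comp (Primrec.fst.comp (Primrec.snd.comp .snd))
        (primrec_pairLists.comp (Primrec.fst.comp .snd) .fst))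
        (Primrec.fst.comp (Primrec.snd.comp (Primrec.snd.comp .snd)))
    exact (h1.or h2).of_eq fun q => by tauto
  · obtain ⟨b, ρ, σ⟩ := b
    constructor
    · rintro ⟨X, hX, h⟩
      obtain ⟨n, hn⟩ := exists_uniform_level_join (R := fun l => R l b) (fun l l' => hm l l' b)
        fun Y hY => (hP _ _).1 (h Y hY)
      let N := max n (max ρ.length σ.length)
      refine ⟨N, by simp [N], initSeg X N, by simp [mem_stringsOfLength hu], ?_, ?_⟩
      · exact hX.prefix_initSeg (by simp [N])
      · intro τ hτ hστ
        simp only [length_initSeg, mem_stringsOfLength hv] at hτ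
        obtain ⟨Y, hY⟩ := exists_extends τ
        have h1 := hn Y (hY.of_prefix hστ)
        have hY' : initSeg Y N = τ := by rw [← hτ]; exact hY
        rw [← hY', ← joinSeq_initSeg]
        exact rel_initSeg_mono hm (by simp [N]) h1
    · rintro ⟨n, hσn, τ, hτ, hρτ, h⟩
      simp only [length_initSeg, mem_stringsOfLength hu] at hτ hσn
      obtain ⟨X, hX⟩ := exists_extends τ
      refine ⟨X, hX.of_prefix hρτ, fun Y hY => (hP _ _).2 ⟨n, ?_⟩⟩
      have := h (initSeg Y n) (by simp [mem_stringsOfLength hv]) (hY.prefix_initSeg hσn)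
      rw [joinSeq_initSeg]
      rwa [← hX, hτ] at this

end Semidec

/-! ### Semidecidability and oracle programs -/

section Jump

variable {β γ ι : Type} [Primcodable β] [Primcodable γ] [Primcodable ι]

open Encodable OracleCode

open Classical in
/-- The characteristic sequence of a set of natural numbers. -/
noncomputable def charSeq (B : Set ℕ) : ℕ → Bool := fun n => decide (n ∈ B)

@[simp]
theorem charSeq_eq_true {B : Set ℕ} {n : ℕ} : charSeq B n = true ↔ n ∈ B := by simp [charSeq]

@[simp]
theorem setOf_charSeq (B : Set ℕ) : {n | charSeq B n = true} = B := by ext; simp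

theorem exists_stringOracle_code :
    ∃ L : Nat.Partrec.Code, ∀ (l : List Bool) (n : ℕ),
      L.eval (Nat.pair (encode l) n) = stringOracle l n := by
  let f : ℕ → Option ℕ := fun x => (decode (α := List Bool) x.unpair.1).bind fun l =>
    l[x.unpair.2]?.map Bool.toNat
  have hf : Primrec f := by
    refine Primrec.option_bind (Primrec.decode.comp (Primrec.fst.comp .unpair)) ?_
    have h : Primrec fun p : ℕ × List Bool => p.2[p.1.unpair.2]?.map Bool.toNat :=
      Primrec.option_map (Primrec.list_getElem?.comp .snd
        (Primrec.snd.comp (Primrec.unpair.comp .fst))) ((Primrec.dom_bool _).comp .snd).to₂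
    exact h.to₂
  obtain ⟨L, hL⟩ := Nat.Partrec.Code.exists_code.1 (Partrec.nat_iff.1 hf.to_comp.ofOption)
  refine ⟨L, fun l n => ?_⟩
  rw [hL]
  simp [f, stringOracle]

/-- The primitive recursive bounded interpreter `evaln`, run on the translated program with the
oracle segment as part of the input, is the witness; its step bound is the extra parameter that is
quantified away. -/
theorem isSemidec_eval :
    IsSemidec fun (Z : ℕ → Bool) (p : ℕ × ℕ × ℕ) =>
      p.2.2 ∈ eval (charFun {n | Z n = true}) (ofIndex p.1) p.2.1 := by
  obtain ⟨L, hL⟩ := exists_stringOracle_code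
  have h : IsSemidec fun (Z : ℕ → Bool) (p : ℕ × ℕ × ℕ × ℕ) => ∃ n,
      Nat.Partrec.Code.evaln p.1 (toCode L (ofIndex p.2.1))
        (Nat.pair (encode (initSeg Z n)) p.2.2.1) = some p.2.2.2 := by
    refine ⟨fun l p => Nat.Partrec.Code.evaln p.1 (toCode L (ofIndex p.2.1))
        (Nat.pair (encode l) p.2.2.1) = some p.2.2.2, ?_, fun Z p => Iff.rfl⟩
    refine Primrec.eq.comp ?_ (Primrec.option_some.comp
      (Primrec.snd.comp (Primrec.snd.comp (Primrec.snd.comp .snd))))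
    exact Nat.Partrec.Code.primrec_evaln.comp (((Primrec.fst.comp .snd).pair
      ((primrec_toCode_ofIndex L).comp (Primrec.fst.comp (Primrec.snd.comp .snd)))).pair
      (Primrec₂.natPair.comp (Primrec.encode.comp .fst)
        (Primrec.fst.comp (Primrec.snd.comp (Primrec.snd.comp .snd)))))
  refine h.exists_param.of_iff fun Z p => ?_
  refine (mem_eval_charFun_iff {n | Z n = true} Z (fun n => Iff.rfl) _ _ _).trans ?_
  rw [exists_comm]
  refine exists_congr fun n => ?_
  rw [← eval_toCode (hL _), Nat.Partrec.Code.evaln_complete]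
  rfl

theorem mem_turingJump_iff {B : Set ℕ} {e : ℕ} :
    e ∈ turingJump B ↔ ∃ y, y ∈ eval (charFun B) (ofIndex e) e := by
  constructor
  · rintro ⟨c, rfl, h⟩
    rw [ofIndex_index]
    exact Part.dom_iff_mem.1 h
  · exact fun h => ⟨ofIndex e, index_ofIndex e, Part.dom_iff_mem.2 h⟩

theorem isSemidec_turingJump :
    IsSemidec fun (Z : ℕ → Bool) e => e ∈ turingJump {n | Z n = true} := by
  have h := isSemidec_eval.comp (f := fun p : ℕ × ℕ => (p.2, p.2, p.1))
    (Primrec.snd.pair (Primrec.snd.pair .fst))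
  exact h.exists_param.of_iff fun Z e => mem_turingJump_iff

theorem OracleCode.exists_of_partrec {f : ℕ →. ℕ} (hf : Nat.Partrec f) :
    ∃ c : OracleCode, ∀ g, eval g c = f := by
  induction hf with
  | zero => exact ⟨zero, fun _ => rfl⟩
  | succ => exact ⟨succ, fun _ => rfl⟩
  | left => exact ⟨left, fun _ => rfl⟩
  | right => exact ⟨right, fun _ => rfl⟩
  | pair _ _ h1 h2 =>
    obtain ⟨c, hc⟩ := h1
    obtain ⟨d, hd⟩ := h2
    exact ⟨pair c d, fun g => by rw [← hc g, ← hd g]; rfl⟩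
  | comp _ _ h1 h2 =>
    obtain ⟨c, hc⟩ := h1
    obtain ⟨d, hd⟩ := h2
    exact ⟨comp c d, fun g => by rw [← hc g, ← hd g]; rfl⟩
  | prec _ _ h1 h2 =>
    obtain ⟨c, hc⟩ := h1
    obtain ⟨d, hd⟩ := h2
    exact ⟨prec c d, fun g => by rw [← hc g, ← hd g]; rfl⟩
  | rfind _ h1 =>
    obtain ⟨c, hc⟩ := h1
    exact ⟨rfind c, fun g => by rw [← hc g]; rfl⟩

theorem OracleCode.exists_of_primrec {f : ℕ → ℕ} (hf : Primrec f) :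
    ∃ c : OracleCode, ∀ g x, eval g c x = Part.some (f x) := by
  obtain ⟨c, hc⟩ := exists_of_partrec (Nat.Partrec.of_primrec (Primrec.nat_iff.1 hf))
  exact ⟨c, fun g x => by rw [hc]; rfl⟩

theorem OracleCode.eval_comp_of_eq {g : ℕ →. ℕ} {c d : OracleCode} {x a : ℕ}
    (h : eval g d x = Part.some a) : eval g (comp c d) x = eval g c a := by
  ext y
  simp [mem_eval_comp, h]

theorem OracleCode.eval_pair_of_eq {g : ℕ →. ℕ} {c d : OracleCode} {x a b : ℕ}
    (h : eval g c x = Part.some a) (h' : eval g d x = Part.some b) :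
    eval g (pair c d) x = Part.some (Nat.pair a b) := by
  ext y
  simp [mem_eval_pair, h, h', eq_comm]

theorem charFun_eq (B : Set ℕ) (n : ℕ) : charFun B n = Part.some (charSeq B n).toNat := by
  by_cases h : n ∈ B <;> simp [charFun, charSeq, h]

/-- A program that outputs initial segments of its oracle. -/
theorem exists_initSeg_code :
    ∃ c : OracleCode, ∀ B n, eval (charFun B) c n = Part.some (encode (initSeg (charSeq B) n)) := by
  obtain ⟨z, hz⟩ := exists_of_primrec (Primrec.const (encode ([] : List Bool)) : Primrec fun _ : ℕ => _)
  obtain ⟨i, hi⟩ := exists_of_primrec Primrec.id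
  obtain ⟨y, hy⟩ := exists_of_primrec (f := fun p : ℕ => p.unpair.2.unpair.1)
    (Primrec.fst.comp (Primrec.unpair.comp (Primrec.snd.comp .unpair)))
  obtain ⟨f, hf⟩ := exists_of_primrec (f := fun p : ℕ =>
      encode (((decode (α := List Bool) p.unpair.1.unpair.2.unpair.2).getD []) ++
        [p.unpair.2.bodd])) (by
    refine Primrec.encode.comp (Primrec.list_append.comp (Primrec.option_getD.comp
      (Primrec.decode.comp (Primrec.snd.comp (Primrec.unpair.comp (Primrec.snd.comp
        (Primrec.unpair.comp (Primrec.fst.comp .unpair)))))) (.const [])) ?_)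
    refine Primrec.list_cons.comp ?_ (.const [])
    exact Primrec.nat_bodd.comp (Primrec.snd.comp .unpair))
  refine ⟨comp (prec z (comp f (pair i (comp oracle y)))) (pair z i), fun B n => ?_⟩
  rw [eval_comp_of_eq (eval_pair_of_eq (hz _ _) (hi _ _))]
  simp only [id]
  generalize ha : encode ([] : List Bool) = a
  induction n with
  | zero => rw [eval_prec_zero, hz]; rfl
  | succ n ih =>
    ext v
    rw [mem_eval_prec_succ, ih]
    simp only [Part.mem_some_iff, exists_eq_left]
    have h1 : ∀ x, eval (charFun B) (comp oracle y) x =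
        Part.some (charSeq B x.unpair.2.unpair.1).toNat := fun x => by
      rw [eval_comp_of_eq (hy _ _)]
      exact charFun_eq _ _
    rw [eval_comp_of_eq (eval_pair_of_eq (hi _ _) (h1 _)), hf]
    have h2 : (charSeq B n).toNat.bodd = charSeq B n := by cases charSeq B n <;> rfl
    simp [initSeg, List.range_succ, h2]

/-- Semidecidable relations can be uniformized by an oracle program. -/
theorem IsSemidec.exists_code {P : (ℕ → Bool) → ι × ℕ → Prop} (hP : IsSemidec P) :
    ∃ c : OracleCode, ∀ (B : Set ℕ) (b : ι),
      (∀ y ∈ eval (charFun B) c (encode b), P (charSeq B) (b, y)) ∧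
      ((∃ y, P (charSeq B) (b, y)) → (eval (charFun B) c (encode b)).Dom) := by
  classical
  obtain ⟨R, hR, hP⟩ := hP
  obtain ⟨s, hs⟩ := exists_initSeg_code
  obtain ⟨i, hi⟩ := exists_of_primrec Primrec.id
  obtain ⟨r, hr⟩ := exists_of_primrec (f := fun p : ℕ => p.unpair.2.unpair.1)
    (Primrec.fst.comp (Primrec.unpair.comp (Primrec.snd.comp .unpair)))
  obtain ⟨v, hv⟩ := exists_of_primrec (f := fun n : ℕ => n.unpair.2) (Primrec.snd.comp .unpair)
  -- The search runs over numbers n that code a stage together with a candidate output. The argument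
  -- of `G` is ((b, n), segment of the oracle at that stage).
  let G : ℕ → Option Bool := fun p =>
    (decode (α := ι) p.unpair.1.unpair.1).bind fun b =>
      (decode (α := List Bool) p.unpair.2).map fun l =>
        decide (R l (b, p.unpair.1.unpair.2.unpair.2))
  have hG : Primrec G := by
    refine Primrec.option_bind (Primrec.decode.comp (Primrec.fst.comp (Primrec.unpair.comp
      (Primrec.fst.comp .unpair)))) ?_
    have h : Primrec fun p : ℕ × ι => (decode (α := List Bool) p.1.unpair.2).map fun l =>
        decide (R l (p.2, p.1.unpair.1.unpair.2.unpair.2)) := by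
      refine Primrec.option_map (Primrec.decode.comp (Primrec.snd.comp
        (Primrec.unpair.comp .fst))) ?_
      have : PrimrecRel fun (p : ℕ × ι) (l : List Bool) =>
          R l (p.2, p.1.unpair.1.unpair.2.unpair.2) :=
        hR.comp .snd ((Primrec.snd.comp .fst).pair (Primrec.snd.comp (Primrec.unpair.comp
          (Primrec.snd.comp (Primrec.unpair.comp (Primrec.fst.comp (Primrec.unpair.comp
            (Primrec.fst.comp .fst))))))))
      exact this.decide
    exact h.to₂
  obtain ⟨q, hq⟩ := exists_of_primrec (f := fun p => if G p = some true then 0 else 1)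
    (Primrec.ite (Primrec.eq.comp hG (.const _)) (.const 0) (.const 1))
  refine ⟨OracleCode.comp v (rfind (OracleCode.comp q (pair i (OracleCode.comp s r)))), fun B b => ?_⟩
  have key : ∀ n, eval (charFun B) (OracleCode.comp q (pair i (OracleCode.comp s r))) (Nat.pair (encode b) n) =
      Part.some (if R (initSeg (charSeq B) n.unpair.1) (b, n.unpair.2) then 0 else 1) := by
    intro n
    have h1 : eval (charFun B) (OracleCode.comp s r) (Nat.pair (encode b) n) =
        Part.some (encode (initSeg (charSeq B) n.unpair.1)) := by
      rw [eval_comp_of_eq (hr _ _), hs, Nat.unpair_pair]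
    rw [eval_comp_of_eq (eval_pair_of_eq (hi _ _) h1), hq]
    simp [G]
  constructor
  · intro y hy
    obtain ⟨n, hn, hy⟩ := mem_eval_comp.1 hy
    have h0 := (mem_eval_rfind.1 hn).1
    rw [key] at h0
    rw [hv] at hy
    simp only [Part.mem_some_iff] at h0 hy
    subst hy
    refine (hP _ _).2 ⟨n.unpair.1, ?_⟩
    by_contra hc
    simp [hc] at h0
  · rintro ⟨y, hy⟩
    obtain ⟨m, hm⟩ := (hP _ _).1 hy
    have hex : ∃ n : ℕ, R (initSeg (charSeq B) n.unpair.1) (b, n.unpair.2) :=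
      ⟨Nat.pair m y, by simpa using hm⟩
    refine Part.dom_iff_mem.2 ⟨_, mem_eval_comp.2 ⟨Nat.find hex, mem_eval_rfind.2 ⟨?_, ?_⟩,
      by rw [hv]; exact Part.mem_some _⟩⟩
    · rw [key, if_pos (Nat.find_spec hex)]
      exact Part.mem_some _
    · intro k hk
      refine ⟨1, one_ne_zero, ?_⟩
      rw [key, if_neg (Nat.find_min hex hk)]
      exact Part.mem_some _

/-- When the relation is the graph of a partial function, a uniformizing program has only one
possible output. -/
theorem IsSemidec.recursiveIn {P : (ℕ → Bool) → ℕ × ℕ → Prop} (hP : IsSemidec P) {B : Set ℕ}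
    {f : ℕ →. ℕ} (hf : ∀ x y, y ∈ f x ↔ P (charSeq B) (x, y)) :
    Nat.RecursiveIn {charFun B} f := by
  obtain ⟨c, hc⟩ := hP.exists_code
  refine (recursiveIn_iff_exists_eval _ _).2 ⟨c, funext fun x => ?_⟩
  obtain ⟨h1, h2⟩ := hc B x
  simp only [encode_nat] at h1 h2
  ext y
  constructor
  · exact fun hy => (hf x y).2 (h1 y hy)
  · intro hy
    obtain ⟨z, hz⟩ := Part.dom_iff_mem.1 (h2 ⟨y, (hf x y).1 hy⟩)
    rwa [Part.mem_unique hy ((hf x z).2 (h1 z hz))]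

/-- A simple s-m-n theorem: the input n is hard-wired by composing with a numeral, a chain of n
successors. -/
theorem OracleCode.primrec_index_comp_const (c : OracleCode) :
    ∃ F : ℕ → OracleCode, (Primrec fun n => (F n).index) ∧
      ∀ g n x, eval g (F n) x = eval g c n := by
  let K : ℕ → OracleCode := fun n => n.rec zero fun _ k => comp succ k
  have hK : ∀ g n x, eval g (K n) x = Part.some n := by
    intro g n x
    induction n with
    | zero => rfl
    | succ n ih => exact eval_comp_of_eq ih
  have hidx : Primrec fun n => (K n).index := by
    -- The Gödel number of `comp succ k`, where i is that of k and 1 is that of `succ`.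
    have h : Primrec₂ fun (_ : ℕ) (i : ℕ) => 4 * Nat.pair 1 i + 6 :=
      Primrec.nat_add.comp (Primrec.nat_mul.comp (.const 4)
        (Primrec₂.natPair.comp (.const 1) .snd)) (.const 6)
    refine (Primrec.nat_rec₁ 0 h).of_eq fun n => ?_
    induction n with
    | zero => rfl
    | succ n ih => simp only [ih]; rfl
  refine ⟨fun n => comp c (K n), ?_, fun g n x => eval_comp_of_eq (hK g n x)⟩
  exact Primrec.nat_add.comp (Primrec.nat_mul.comp (.const 4)
    (Primrec₂.natPair.comp (.const c.index) hidx)) (.const 6)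

/-- Semidecidable predicates are uniformly many-one reducible to the jump of the oracle. -/
theorem IsSemidec.exists_jump_index_set {P : (ℕ → Bool) → ι → Prop} (hP : IsSemidec P) :
    ∃ g : ι → ℕ, Primrec g ∧ ∀ (B : Set ℕ) b, P (charSeq B) b ↔ g b ∈ turingJump B := by
  -- Only halting matters, so `P` receives a dummy output coordinate.
  obtain ⟨c, hc⟩ := (hP.comp (Primrec.fst : Primrec (Prod.fst : ι × ℕ → ι))).exists_code
  obtain ⟨F, hF, hFe⟩ := primrec_index_comp_const c
  refine ⟨fun b => (F (encode b)).index, hF.comp .encode, fun B b => ?_⟩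
  rw [mem_turingJump_iff, ofIndex_index, hFe]
  obtain ⟨h1, h2⟩ := hc B b
  exact ⟨fun h => Part.dom_iff_mem.1 (h2 ⟨0, h⟩), fun ⟨y, hy⟩ => h1 y hy⟩

/-! ### Turing reducibility -/

theorem setTuringLE_refl (A : Set ℕ) : SetTuringLE A A := TuringReducible.refl _

theorem SetTuringLE.trans {A B C : Set ℕ} (h : SetTuringLE A B) (h' : SetTuringLE B C) :
    SetTuringLE A C := TuringReducible.trans h h'

theorem setTuringLE_iff {A B : Set ℕ} :
    SetTuringLE A B ↔ Nat.RecursiveIn {charFun B} (charFun A) := RecursiveIn.iff_nat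

theorem setTuringLE_of_manyOne {A B : Set ℕ} {g : ℕ → ℕ} (hg : Primrec g)
    (h : ∀ n, n ∈ A ↔ g n ∈ B) : SetTuringLE A B := by
  rw [setTuringLE_iff]
  refine (Nat.RecursiveIn.comp (.oracle (charFun B) (Set.mem_singleton _)) (Nat.Primrec.recursiveIn (Primrec.nat_iff.1 hg))).of_eq
    fun n => ?_
  change Part.bind (Part.some (g n)) (fun a => charFun B a) = _
  rw [Part.bind_some, charFun, charFun]
  by_cases hn : n ∈ A
  · rw [if_pos hn, if_pos ((h n).1 hn)]
  · rw [if_neg hn, if_neg fun hc => hn ((h n).2 hc)]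

theorem setTuringLE_of_semidec_bool {P Q : (ℕ → Bool) → ℕ → Prop} (hP : IsSemidec P)
    (hQ : IsSemidec Q) {A B : Set ℕ} (h : ∀ n, n ∈ A ↔ P (charSeq B) n)
    (h' : ∀ n, n ∉ A ↔ Q (charSeq B) n) : SetTuringLE A B := by
  rw [setTuringLE_iff]
  have hV : IsSemidec fun (Z : ℕ → Bool) (p : ℕ × ℕ) =>
      (P Z p.1 ∧ p.2 = 1) ∨ (Q Z p.1 ∧ p.2 = 0) :=
    ((hP.comp .fst).and (.of_primrecPred (Primrec.eq.comp .snd (.const 1)))).or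
      ((hQ.comp .fst).and (.of_primrecPred (Primrec.eq.comp .snd (.const 0))))
  refine hV.recursiveIn fun x y => ?_
  rw [← h, ← h']
  by_cases hx : x ∈ A <;> simp [charFun, hx]

/-- One half of Post's theorem, whose other half is `setTuringLE_of_semidec_bool`. The two
predicates need be complementary only at the oracle B. -/
theorem SetTuringLE.exists_semidec {A B : Set ℕ} (h : SetTuringLE A B) :
    ∃ P Q : (ℕ → Bool) → ℕ → Prop, IsSemidec P ∧ IsSemidec Q ∧
      (∀ n, n ∈ A ↔ P (charSeq B) n) ∧ ∀ n, n ∉ A ↔ Q (charSeq B) n := by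
  obtain ⟨c, hc⟩ := (recursiveIn_iff_exists_eval _ _).1 (setTuringLE_iff.1 h)
  have hs : ∀ y : ℕ, IsSemidec fun (Z : ℕ → Bool) (n : ℕ) =>
      y ∈ eval (charFun {n | Z n = true}) (ofIndex c.index) n := fun y =>
    isSemidec_eval.comp (f := fun n : ℕ => (c.index, n, y))
      ((Primrec.const _).pair (Primrec.id.pair (.const _)))
  refine ⟨_, _, hs 1, hs 0, fun n => ?_, fun n => ?_⟩ <;>
  · rw [setOf_charSeq, ofIndex_index, hc]
    by_cases hx : n ∈ A <;> simp [charFun, hx]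

/-- The diagonal function relative to A becomes recursive in B by substituting a program for the
oracle, so its halting set is semidecidable in B. -/
theorem SetTuringLE.turingJump {A B : Set ℕ} (h : SetTuringLE A B) :
    SetTuringLE (turingJump A) (turingJump B) := by
  have h1 : Nat.RecursiveIn {charFun A} fun e => eval (charFun A) (ofIndex e) e := by
    refine (isSemidec_eval.comp (f := fun p : ℕ × ℕ => (p.1, p.1, p.2))
      (Primrec.fst.pair .id)).recursiveIn fun x y => ?_
    rw [setOf_charSeq]
  have h2 := h1.subst (O' := {charFun B}) (by simpa using setTuringLE_iff.1 h)
  obtain ⟨d, hd⟩ := (recursiveIn_iff_exists_eval _ _).1 h2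
  have h3 : IsSemidec fun (Z : ℕ → Bool) (e : ℕ) => ∃ y,
      y ∈ eval (charFun {n | Z n = true}) (ofIndex d.index) e :=
    (isSemidec_eval.comp (f := fun p : ℕ × ℕ => (d.index, p.2, p.1))
      ((Primrec.const _).pair (Primrec.snd.pair .fst))).exists_param
  obtain ⟨g, hg, hgB⟩ := h3.exists_jump_index_set
  refine setTuringLE_of_manyOne hg fun e => ?_
  rw [← hgB, setOf_charSeq, ofIndex_index, hd, mem_turingJump_iff]

theorem setTuringLE_setJoin {A B C : Set ℕ} (hA : SetTuringLE A C) (hB : SetTuringLE B C) :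
    SetTuringLE (setJoin A B) C := by
  obtain ⟨P, P', hP, hP', h1, h2⟩ := hA.exists_semidec
  obtain ⟨Q, Q', hQ, hQ', h3, h4⟩ := hB.exists_semidec
  have hhalf : Primrec fun n : ℕ => n / 2 := Primrec.nat_div.comp .id (.const 2)
  have hmod : ∀ i : ℕ, PrimrecPred fun n : ℕ => n % 2 = i := fun i =>
    Primrec.eq.comp (Primrec.nat_mod.comp .id (.const 2)) (.const i)
  have hmem : ∀ n, n ∈ setJoin A B ↔ (n % 2 = 0 ∧ n / 2 ∈ A) ∨ (n % 2 = 1 ∧ n / 2 ∈ B) := by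
    intro n
    constructor
    · rintro (⟨m, hm, rfl⟩ | ⟨m, hm, rfl⟩)
      · left; simpa using hm
      · right
        rw [show (2 * m + 1) / 2 = m by omega]
        exact ⟨by omega, hm⟩
    · rintro (⟨h, hm⟩ | ⟨h, hm⟩)
      · exact .inl ⟨_, hm, by omega⟩
      · exact .inr ⟨_, hm, by omega⟩
  refine setTuringLE_of_semidec_bool
    (((IsSemidec.of_primrecPred (hmod 0)).and (hP.comp hhalf)).or
      ((IsSemidec.of_primrecPred (hmod 1)).and (hQ.comp hhalf)))
    (((IsSemidec.of_primrecPred (hmod 0)).and (hP'.comp hhalf)).or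
      ((IsSemidec.of_primrecPred (hmod 1)).and (hQ'.comp hhalf))) (fun n => ?_) (fun n => ?_)
  · rw [hmem, h1, h3]
  · rw [hmem, ← h2, ← h4]
    rcases Nat.mod_two_eq_zero_or_one n with h | h <;> simp [h]

/-! ### Graphs of sequences -/

/-- The coded graph of a sequence. -/
def seqGraph (Z : ℕ → γ) : Set ℕ := {k | ∃ n, encode (n, Z n) = k}

theorem encode_mem_seqGraph {Z : ℕ → γ} {n : ℕ} {a : γ} :
    encode (n, a) ∈ seqGraph Z ↔ Z n = a := by
  constructor
  · rintro ⟨m, hm⟩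
    have := encode_injective hm
    rw [Prod.mk.injEq] at this
    rw [← this.1, this.2]
  · rintro rfl
    exact ⟨n, rfl⟩

/-- The code of (m, a) is at least m, so the first n bits of the graph depend only on the first n
entries of the sequence. -/
theorem IsSemidec.of_graph {P : (ℕ → Bool) → ι → Prop} (hP : IsSemidec P) :
    IsSemidec fun (Z : ℕ → γ) b => P (charSeq (seqGraph Z)) b := by
  classical
  refine hP.comp_oracle (F := fun Z => charSeq (seqGraph Z))
    (φ := fun l => (List.range l.length).map fun k =>
      decide (((decode₂ (ℕ × γ) k).bind fun p => l[p.1]?.map fun a => decide (a = p.2)) =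
        some true)) ?_ fun Z n => ?_
  · refine Primrec.list_map (Primrec.list_range.comp Primrec.list_length) ?_
    have h : Primrec fun q : List γ × ℕ =>
        (decode₂ (ℕ × γ) q.2).bind fun p => q.1[p.1]?.map fun a => decide (a = p.2) := by
      refine Primrec.option_bind (Primrec.decode₂.comp .snd) ?_
      have h' : Primrec fun q : (List γ × ℕ) × ℕ × γ =>
          q.1.1[q.2.1]?.map fun a => decide (a = q.2.2) :=
        Primrec.option_map (Primrec.list_getElem?.comp (Primrec.fst.comp .fst)
          (Primrec.fst.comp .snd))
          (PrimrecPred.decide (Primrec.eq.comp .snd (Primrec.snd.comp (Primrec.snd.comp .fst)))).to₂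
      exact h'.to₂
    exact (PrimrecPred.decide (Primrec.eq.comp h (.const _))).to₂
  · rw [length_initSeg]
    refine List.map_congr_left fun k hk => ?_
    rw [List.mem_range] at hk
    rw [Bool.eq_iff_iff, charSeq_eq_true, decide_eq_true_iff]
    constructor
    · rintro ⟨m, rfl⟩
      have hm : m < n := lt_of_le_of_lt (by rw [encode_prod_val]; exact Nat.left_le_pair _ _) hk
      rw [encodek₂]
      simp [OracleCode.initSeg_getElem?, hm]
    · intro h
      rw [Option.bind_eq_some_iff] at h
      obtain ⟨⟨m, a⟩, hd, h⟩ := h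
      rw [OracleCode.initSeg_getElem?] at h
      split_ifs at h with hm
      · simp only [Option.map_some, Option.some.injEq, decide_eq_true_eq] at h
        subst h
        refine ⟨m, ?_⟩
        exact mem_decode₂.1 hd
      · simp at h

/-- The jump of the coded graph of a sequence. -/
def seqJump (Z : ℕ → γ) : Set ℕ := turingJump (seqGraph Z)

theorem isSemidec_seqJump : IsSemidec fun (Z : ℕ → γ) e => e ∈ seqJump Z :=
  isSemidec_turingJump.of_graph.of_iff fun Z e => by rw [setOf_charSeq, seqJump]

/-- That a string is an initial segment of Z is confirmed by finitely many positive bits of the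
graph, so one can search for a confirmed string that is accepted. -/
theorem IsSemidec.exists_bool {P : (ℕ → γ) → ι → Prop} (hP : IsSemidec P) :
    ∃ Q : (ℕ → Bool) → ι → Prop, IsSemidec Q ∧
      ∀ Z b, P Z b ↔ Q (charSeq (seqGraph Z)) b := by
  obtain ⟨R, hR, hP⟩ := hP
  let f : List γ → List ℕ := fun l =>
    (List.range l.length).filterMap fun i => l[i]?.map fun a => encode (i, a)
  have hf : Primrec f := by
    refine Primrec.listFilterMap (Primrec.list_range.comp Primrec.list_length) ?_
    have h : Primrec fun p : List γ × ℕ => p.1[p.2]?.map fun a => encode (p.2, a) :=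
      Primrec.option_map (Primrec.list_getElem?.comp .fst .snd)
        (Primrec.encode.comp ((Primrec.snd.comp .fst).pair .snd)).to₂
    exact h.to₂
  have hS : IsSemidec fun (Z : ℕ → Bool) (p : List γ × ι) =>
      ∃ n, (∀ k ∈ f p.1, (initSeg Z n)[k]? = some true) ∧ R p.1 p.2 := by
    refine ⟨fun z p => (∀ k ∈ f p.1, z[k]? = some true) ∧ R p.1 p.2, ?_, fun Z p => Iff.rfl⟩
    refine PrimrecPred.and (PrimrecPred.forall_mem_list' (ι := List Bool × List γ × ι)
      (R := fun k q => q.1[k]? = some true) (f := fun q => f q.2.1)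
      (hf.comp (Primrec.fst.comp .snd)) ?_)
      (hR.comp (Primrec.fst.comp .snd) (Primrec.snd.comp .snd))
    exact Primrec.eq.comp (Primrec.list_getElem?.comp (Primrec.fst.comp .snd) .fst) (.const _)
  refine ⟨_, hS.exists_param, fun Z b => ?_⟩
  rw [hP]
  have hmem : ∀ (l : List γ) (k : ℕ), k ∈ f l ↔ ∃ (i : ℕ) (a : γ), l[i]? = some a ∧ encode (i, a) = k := by
    intro l k
    simp only [f, List.mem_filterMap, List.mem_range, Option.map_eq_some_iff]
    constructor
    · rintro ⟨i, -, a, h⟩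
      exact ⟨i, a, h⟩
    · rintro ⟨i, a, h, h'⟩
      exact ⟨i, (List.getElem?_eq_some_iff.1 h).1, a, h, h'⟩
  constructor
  · rintro ⟨n, hn⟩
    obtain ⟨N, hN⟩ : ∃ N, ∀ k ∈ f (initSeg Z n), k < N :=
      ⟨(f (initSeg Z n)).sum + 1, fun k hk => Nat.lt_succ_of_le (List.le_sum_of_mem hk)⟩
    refine ⟨initSeg Z n, N, fun k hk => ?_, hn⟩
    have hkN := hN k hk
    obtain ⟨i, a, hia, rfl⟩ := (hmem _ _).1 hk
    rw [initSeg_getElem?, if_pos hkN, Option.some_inj, charSeq_eq_true, encode_mem_seqGraph]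
    rw [initSeg_getElem?] at hia
    split_ifs at hia
    exact Option.some_inj.1 hia
  · rintro ⟨l, n, h, hl⟩
    refine ⟨l.length, ?_⟩
    have : initSeg Z l.length = l := by
      refine List.ext_getElem (by simp) fun i h1 h2 => ?_
      have h3 := h (encode (i, l[i])) ((hmem _ _).2 ⟨i, l[i], by simp, rfl⟩)
      rw [initSeg_getElem?] at h3
      split_ifs at h3
      rw [Option.some_inj, charSeq_eq_true, encode_mem_seqGraph] at h3
      simpa [initSeg] using h3
    rwa [this]

theorem IsSemidec.exists_jump_index {P : (ℕ → γ) → ι → Prop} (hP : IsSemidec P) :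
    ∃ g : ι → ℕ, Primrec g ∧ ∀ Z b, P Z b ↔ g b ∈ seqJump Z := by
  obtain ⟨Q, hQ, h⟩ := hP.exists_bool
  obtain ⟨g, hg, hgB⟩ := hQ.exists_jump_index_set
  exact ⟨g, hg, fun Z b => by rw [h, hgB, seqJump]⟩

theorem setTuringLE_of_semidec {P Q : (ℕ → γ) → ℕ → Prop} (hP : IsSemidec P)
    (hQ : IsSemidec Q) {A : Set ℕ} {Z : ℕ → γ} (h : ∀ n, n ∈ A ↔ P Z n)
    (h' : ∀ n, n ∉ A ↔ Q Z n) : SetTuringLE A (seqGraph Z) := by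
  obtain ⟨P', hP', hPP⟩ := hP.exists_bool
  obtain ⟨Q', hQ', hQQ⟩ := hQ.exists_bool
  exact setTuringLE_of_semidec_bool hP' hQ' (fun n => (h n).trans (hPP Z n))
    (fun n => (h' n).trans (hQQ Z n))

theorem isSemidec_bit (v : Bool) : IsSemidec fun (Z : ℕ → Bool) n => Z n = v := by
  refine ⟨fun l n => l[n]? = some v, Primrec.eq.comp Primrec.list_getElem? (.const _),
    fun Z n => ?_⟩
  simp only [initSeg_getElem?]
  constructor
  · exact fun h => ⟨n + 1, by simp [h]⟩
  · rintro ⟨m, hm⟩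
    split_ifs at hm
    simpa using hm

theorem seqGraph_comp_le {Z : ℕ → γ} {f : ℕ → γ → β} (hf : Primrec₂ f) :
    SetTuringLE (seqGraph fun n => f n (Z n)) (seqGraph Z) := by
  have h : ∀ v, IsSemidec fun (Z : ℕ → γ) k =>
      charSeq (seqGraph fun n => f n (Z n)) k = v := fun v =>
    ((isSemidec_bit v).of_graph (γ := β)).comp_pointwise hf
  refine setTuringLE_of_semidec (h true) (h false) (fun n => ?_) (fun n => ?_)
  · rw [charSeq_eq_true]
  · rw [← Bool.not_eq_true, charSeq_eq_true]

/-- Links the two codings of an oracle: constructions use sequences, lowness speaks of sets. -/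
theorem seqJump_charSeq_le (B : Set ℕ) : SetTuringLE (seqJump (charSeq B)) (turingJump B) := by
  obtain ⟨g, hg, hgB⟩ := (isSemidec_seqJump (γ := Bool)).exists_jump_index_set
  exact setTuringLE_of_manyOne hg (hgB B)

end Jump

/-! ### Constructions computable in the jump -/

section JumpConstruction

open Encodable OracleCode

variable {γ κ : Type} [Primcodable γ] [Primcodable κ]

/-- A sequence each of whose terms is found by a search for an object with a co-semidecidable
property of its predecessor can be computed from the jump. -/
theorem exists_seq_le_seqJump {S : (ℕ → γ) → ℕ × κ × κ → Prop} (hS : IsSemidec S) (A : ℕ → γ)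
    (Inv : ℕ → κ → Prop) (p₀ : κ) (h0 : Inv 0 p₀)
    (hex : ∀ i p, Inv i p → ∃ q, ¬ S A (i, p, q))
    (hinv : ∀ i p q, Inv i p → ¬ S A (i, p, q) → Inv (i + 1) q) :
    ∃ p : ℕ → κ, p 0 = p₀ ∧ (∀ i, Inv i (p i)) ∧ (∀ i, ¬ S A (i, p i, p (i + 1))) ∧
      ∀ f : κ → Bool, Primrec f → SetTuringLE {i | f (p i) = true} (seqJump A) := by
  obtain ⟨g, hg, hgJ⟩ := hS.exists_jump_index
  -- An index that always lies in the jump. It is the default value of `G`, so that numbers coding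
  -- no object are never accepted by the search.
  obtain ⟨t, -, ht⟩ := (IsSemidec.of_primrecPred (γ := γ) (ι := Unit) (p := fun _ => True)
    (Primrec.primrecPred (by simpa using Primrec.const true))).exists_jump_index
  let G : ℕ → ℕ := fun x =>
    ((decode₂ κ x.unpair.1.unpair.2.unpair.2).bind fun p =>
      (decode₂ κ x.unpair.2).map fun q => g (x.unpair.1.unpair.2.unpair.1, p, q)).getD (t ())
  have hG : Primrec G := by
    refine Primrec.option_getD.comp (Primrec.option_bind (Primrec.decode₂.comp
      (Primrec.snd.comp (Primrec.unpair.comp (Primrec.snd.comp (Primrec.unpair.comp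
        (Primrec.fst.comp .unpair)))))) ?_) (.const _)
    have h : Primrec fun y : ℕ × κ => (decode₂ κ y.1.unpair.2).map fun q =>
        g (y.1.unpair.1.unpair.2.unpair.1, y.2, q) := by
      refine Primrec.option_map (Primrec.decode₂.comp (Primrec.snd.comp
        (Primrec.unpair.comp .fst))) ?_
      exact (hg.comp ((Primrec.fst.comp (Primrec.unpair.comp (Primrec.snd.comp
        (Primrec.unpair.comp (Primrec.fst.comp (Primrec.unpair.comp
          (Primrec.fst.comp .fst))))))).pair ((Primrec.snd.comp .fst).pair .snd))).to₂
    exact h.to₂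
  have hGval : ∀ a i p n, G (Nat.pair (Nat.pair a (Nat.pair i (encode p))) n) ∉ seqJump A ↔
      ∃ q : κ, encode q = n ∧ ¬ S A (i, p, q) := by
    intro a i p n
    simp only [G, Nat.unpair_pair, encodek₂, Option.bind_some]
    cases hd : decode₂ κ n with
    | none =>
      simp only [Option.map_none, Option.getD_none, ← ht, not_true_eq_false, false_iff]
      rintro ⟨q, hq, -⟩
      rw [← mem_decode₂, hd] at hq
      cases hq
    | some q =>
      have hq : encode q = n := mem_decode₂.1 hd
      simp only [Option.map_some, Option.getD_some, ← hgJ]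
      constructor
      · exact fun h => ⟨q, hq, h⟩
      · rintro ⟨q', hq', h⟩
        rwa [encode_injective (hq.trans hq'.symm)]
  obtain ⟨d, hd⟩ := exists_of_primrec hG
  obtain ⟨z, hz⟩ := exists_of_primrec (Primrec.const (encode p₀) : Primrec fun _ : ℕ => _)
  obtain ⟨o, ho⟩ := exists_of_primrec (Primrec.const 0 : Primrec fun _ : ℕ => _)
  obtain ⟨id', hid⟩ := exists_of_primrec Primrec.id
  let J := charFun (seqJump A)
  -- Primitive recursion over the step number, with dummy parameter 0; each step takes the least
  -- code that the jump does not reject.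
  let C : OracleCode := .prec z (.rfind (.comp .oracle d))
  have hsearch : ∀ x, eval J (.comp .oracle d) x =
      Part.some (charSeq (seqJump A) (G x)).toNat := fun x => by
    rw [eval_comp_of_eq (hd _ _)]
    exact charFun_eq _ _
  have hfind : ∀ x n, n ∈ eval J (.rfind (.comp .oracle d)) x ↔
      G (Nat.pair x n) ∉ seqJump A ∧ ∀ m < n, G (Nat.pair x m) ∈ seqJump A := by
    intro x n
    have h1 : ∀ k, 0 = (charSeq (seqJump A) k).toNat ↔ k ∉ seqJump A := by
      intro k
      rw [← charSeq_eq_true]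
      cases charSeq (seqJump A) k <;> simp
    have h2 : ∀ k, (∃ v, v ≠ 0 ∧ v = (charSeq (seqJump A) k).toNat) ↔ k ∈ seqJump A := by
      intro k
      rw [← charSeq_eq_true]
      cases charSeq (seqJump A) k <;> simp
    rw [mem_eval_rfind]
    simp only [hsearch, Part.mem_some_iff, h1, h2]
  have hmain : ∀ i, ∃ p, Inv i p ∧ encode p ∈ eval J C (Nat.pair 0 i) := by
    intro i
    induction i with
    | zero =>
      refine ⟨p₀, h0, ?_⟩
      rw [eval_prec_zero, hz]
      exact Part.mem_some _
    | succ i ih =>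
      classical
      obtain ⟨p, hp, hpC⟩ := ih
      have hex' : ∃ n, G (Nat.pair (Nat.pair 0 (Nat.pair i (encode p))) n) ∉ seqJump A := by
        obtain ⟨q, hq⟩ := hex i p hp
        exact ⟨encode q, (hGval _ _ _ _).2 ⟨q, rfl, hq⟩⟩
      obtain ⟨q, hq, hqS⟩ := (hGval _ _ _ _).1 (Nat.find_spec hex')
      refine ⟨q, hinv i p q hp hqS, mem_eval_prec_succ.2 ⟨_, hpC, (hfind _ _).2 ?_⟩⟩
      rw [hq]
      exact ⟨Nat.find_spec hex', fun m hm => not_not.1 (Nat.find_min hex' hm)⟩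
  choose p hpInv hpC using hmain
  refine ⟨p, ?_, hpInv, fun i => ?_, fun f hf => ?_⟩
  · have h := hpC 0
    rw [eval_prec_zero, hz, Part.mem_some_iff] at h
    exact encode_injective h
  · obtain ⟨v, hv, hv'⟩ := mem_eval_prec_succ.1 (hpC (i + 1))
    rw [Part.mem_unique hv (hpC i), hfind, hGval] at hv'
    obtain ⟨⟨q, hq, hqS⟩, -⟩ := hv'
    rwa [encode_injective hq] at hqS
  · obtain ⟨c, hc⟩ := exists_of_primrec (f := fun n =>
      if (decode (α := κ) n).map f = some true then 1 else 0)
      (Primrec.ite (Primrec.eq.comp (Primrec.option_map .decode (hf.comp .snd).to₂) (.const _))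
        (.const 1) (.const 0))
    rw [setTuringLE_iff, recursiveIn_iff_exists_eval]
    refine ⟨.comp c (.comp C (.pair o id')), funext fun i => ?_⟩
    have h1 : eval J (.comp C (.pair o id')) i = Part.some (encode (p i)) := by
      rw [eval_comp_of_eq (eval_pair_of_eq (ho _ _) (hid _ _))]
      exact Part.eq_some_iff.2 (hpC i)
    rw [eval_comp_of_eq h1, hc, charFun]
    by_cases h : f (p i) = true <;> simp [h]

end JumpConstruction

/-! ### The low basis theorem for left-full classes -/

section LowBasis

variable {α β γ : Type}

/-- If the cell τ fails for one X, it fails on a neighborhood of X because failure is open.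
Restricting to that neighborhood removes τ from the list, and after finitely many removals some cell
serves all X of a cone. -/
theorem exists_cell_of_forall [Inhabited α] {Q : (ℕ → α) → (ℕ → β) → Prop}
    (hopen : ∀ τ X, (∀ Y, Extends τ Y → ¬ Q X Y) →
      ∃ n, ∀ X', Extends (initSeg X n) X' → ∀ Y, Extends τ Y → ¬ Q X' Y)
    (L : List (List β)) (ρ : List α)
    (h : ∀ X, Extends ρ X → ∃ τ ∈ L, ∃ Y, Extends τ Y ∧ Q X Y) :
    ∃ τ ∈ L, ∃ ρ', ρ <+: ρ' ∧ ∀ X, Extends ρ' X → ∃ Y, Extends τ Y ∧ Q X Y := by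
  induction L generalizing ρ with
  | nil =>
    obtain ⟨X, hX⟩ := exists_extends ρ
    simpa using h X hX
  | cons τ L ih =>
    by_cases hτ : ∃ X, Extends ρ X ∧ ∀ Y, Extends τ Y → ¬ Q X Y
    · obtain ⟨X, hX, hXτ⟩ := hτ
      obtain ⟨n, hn⟩ := hopen τ X hXτ
      have hρ : ρ <+: initSeg X (max n ρ.length) := hX.prefix_initSeg (le_max_right _ _)
      obtain ⟨τ', hτ', ρ', hρ', h'⟩ := ih (initSeg X (max n ρ.length)) fun X' hX' => by
        obtain ⟨τ', hτ', Y, hY, hQ⟩ := h X' (hX'.of_prefix hρ)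
        rcases List.mem_cons.1 hτ' with rfl | hτ'
        · exact absurd hQ (hn X' (hX'.of_prefix (initSeg_prefix X (le_max_left _ _))) Y hY)
        · exact ⟨τ', hτ', Y, hY, hQ⟩
      exact ⟨τ', List.mem_cons_of_mem _ hτ', ρ', hρ.trans hρ', h'⟩
    · push Not at hτ
      exact ⟨τ, List.mem_cons_self, ρ, List.prefix_rfl, hτ⟩

theorem exists_limit_of_chain [Inhabited α] (ρ : ℕ → List α) (h : ∀ k, ρ k <+: ρ (k + 1))
    (hl : ∀ k, k ≤ (ρ (k + 1)).length) : ∃ X, ∀ k, Extends (ρ k) X := by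
  have hmono : ∀ k m, k ≤ m → ρ k <+: ρ m := by
    intro k m hkm
    induction m, hkm using Nat.le_induction with
    | base => exact List.prefix_rfl
    | succ m _ ih => exact ih.trans (h m)
  -- The length bound is shifted by one: ρ (n + 2) has length at least n + 1, so its n-th entry
  -- exists.
  refine ⟨fun n => (ρ (n + 2))[n]?.getD default, fun k => List.ext_getElem (by simp) ?_⟩
  intro i h1 h2
  have h3 : i < (ρ (i + 2)).length := hl (i + 1)
  have key : (ρ (i + 2))[i]? = (ρ k)[i]? := by
    rcases le_total (i + 2) k with hk | hk
    · rw [List.getElem?_eq_getElem h3, List.getElem?_eq_getElem h2]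
      exact congrArg some ((hmono _ _ hk).getElem h3)
    · rw [List.getElem?_eq_getElem h3, List.getElem?_eq_getElem h2]
      exact congrArg some ((hmono _ _ hk).getElem h2).symm
  simp [initSeg, key, h2]

variable [Primcodable α] [Primcodable β] [Primcodable γ]

/-- Every `X` extending `ρ` has a companion `Y` extending `σ` for which the `e`-th computation
with oracle `(A, X, Y)` diverges. -/
def LeftFullBelow (A : ℕ → γ) (ρ : List α) (σ : List β) (e : ℕ) : Prop :=
  ∀ X, Extends ρ X → ∃ Y, Extends σ Y ∧ e ∉ seqJump (joinSeq A X Y)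

theorem LeftFullBelow.of_prefix {A : ℕ → γ} {ρ ρ' : List α} {σ : List β} {e : ℕ}
    (h : LeftFullBelow A ρ σ e) (hρ : ρ <+: ρ') : LeftFullBelow A ρ' σ e :=
  fun X hX => h X (hX.of_prefix hρ)

/-- Every X has a companion in one of the finitely many cells that refine σ, so some cell works on a
whole cone by `exists_cell_of_forall`. Lengthening ρ afterwards costs nothing. -/
theorem LeftFullBelow.exists_extension [Finite β] [Inhabited α] [Inhabited β] {A : ℕ → γ}
    {ρ : List α} {σ : List β} {e : ℕ} (h : LeftFullBelow A ρ σ e) (n : ℕ) :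
    ∃ ρ' σ', ρ <+: ρ' ∧ σ <+: σ' ∧ n ≤ ρ'.length ∧ n ≤ σ'.length ∧ LeftFullBelow A ρ' σ' e := by
  obtain ⟨R, -, hm, hR⟩ :=
    (isSemidec_seqJump (γ := γ × α × β)).exists_mono
  obtain ⟨v, hv⟩ : ∃ v : List β, ∀ a, a ∈ v := by
    have := Fintype.ofFinite β
    exact ⟨Finset.univ.toList, by simp⟩
  classical
  let N := max n σ.length
  obtain ⟨τ, hτ, ρ', hρ', h'⟩ := exists_cell_of_forall
    (Q := fun X Y => e ∉ seqJump (joinSeq A X Y)) (by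
      intro τ X hX
      simp only [not_not] at hX ⊢
      obtain ⟨n, hn⟩ := exists_uniform_level_join (R := fun l => R l e)
        (fun l l' => hm l l' e) fun Y hY => (hR _ _).1 (hX Y hY)
      refine ⟨n, fun X' hX' Y hY => (hR _ _).2 ⟨n, ?_⟩⟩
      have heq : initSeg (joinSeq A X' Y) n = initSeg (joinSeq A X Y) n := by
        rw [initSeg_eq_iff]
        intro i hi
        simp only [joinSeq, extends_initSeg_iff.1 hX' i hi]
      rw [heq]
      exact hn Y hY)
    ((stringsOfLength v N).filter fun τ => decide (σ <+: τ)) ρ (by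
      intro X hX
      obtain ⟨Y, hY, he⟩ := h X hX
      refine ⟨initSeg Y N, ?_, Y, extends_initSeg Y N, he⟩
      simp only [List.mem_filter, mem_stringsOfLength hv, length_initSeg, decide_eq_true_eq,
        true_and]
      exact hY.prefix_initSeg (le_max_right _ _))
  simp only [List.mem_filter, mem_stringsOfLength hv, decide_eq_true_eq] at hτ
  obtain ⟨X, hX⟩ := exists_extends ρ'
  have hpre : ρ' <+: initSeg X (max n ρ'.length) := hX.prefix_initSeg (le_max_right _ _)
  refine ⟨_, τ, hρ'.trans hpre, hτ.2, by simp, by rw [hτ.1]; exact le_max_left _ _, ?_⟩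
  exact LeftFullBelow.of_prefix h' hpre

end LowBasis

/-! ### The forcing construction -/

section LowBasis

variable {α β γ : Type} [Primcodable α] [Primcodable β] [Primcodable γ]

/-- The combinatorial part of the step relation in the proof of the low basis theorem: the
strings are extended, and the list of computations kept divergent grows only if the last
component is `true`. -/
def IsStep (j : ℕ × ℕ → ℕ) (i : ℕ) (p q : List α × List β × ℕ × Bool) : Prop :=
  p.1 <+: q.1 ∧ p.2.1 <+: q.2.1 ∧ i ≤ q.1.length ∧ i ≤ q.2.1.length ∧
    ((q.2.2.2 = true ∧ q.2.2.1 = j (p.2.2.1, i)) ∨ (q.2.2.2 = false ∧ q.2.2.1 = p.2.2.1))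

theorem primrecPred_isStep {j : ℕ × ℕ → ℕ} (hj : Primrec j) :
    PrimrecPred fun x : ℕ × (List α × List β × ℕ × Bool) × (List α × List β × ℕ × Bool) =>
      IsStep j x.1 x.2.1 x.2.2 := by
  have hp : Primrec fun x : ℕ × (List α × List β × ℕ × Bool) × (List α × List β × ℕ × Bool) =>
    x.2.1 := Primrec.fst.comp .snd
  have hq : Primrec fun x : ℕ × (List α × List β × ℕ × Bool) × (List α × List β × ℕ × Bool) =>
    x.2.2 := Primrec.snd.comp .snd
  have he : Primrec fun p : List α × List β × ℕ × Bool => p.2.2.1 :=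
    Primrec.fst.comp (Primrec.snd.comp .snd)
  have hb : Primrec fun p : List α × List β × ℕ × Bool => p.2.2.2 :=
    Primrec.snd.comp (Primrec.snd.comp .snd)
  refine PrimrecPred.and (primrecRel_prefix.comp (Primrec.fst.comp hp) (Primrec.fst.comp hq)) <|
    .and (primrecRel_prefix.comp (Primrec.fst.comp (Primrec.snd.comp hp))
      (Primrec.fst.comp (Primrec.snd.comp hq))) <|
    .and (Primrec.nat_le.comp .fst (Primrec.list_length.comp (Primrec.fst.comp hq))) <|
    .and (Primrec.nat_le.comp .fst (Primrec.list_length.comp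
      (Primrec.fst.comp (Primrec.snd.comp hq)))) <| .or ?_ ?_
  · exact .and (Primrec.eq.comp (hb.comp hq) (.const _))
      (Primrec.eq.comp (he.comp hq) (hj.comp ((he.comp hp).pair .fst)))
  · exact .and (Primrec.eq.comp (hb.comp hq) (.const _))
      (Primrec.eq.comp (he.comp hq) (he.comp hp))

/-- The string of length `min |ρ| |σ|` determined by the oracle `A` and the strings `ρ`, `σ`. -/
def joinString (A : ℕ → γ) (ρ : List α) (σ : List β) : List (γ × α × β) :=
  pairLists (initSeg A (min ρ.length σ.length))
    (pairLists (ρ.take (min ρ.length σ.length)) (σ.take (min ρ.length σ.length)))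

omit [Primcodable α] [Primcodable β] [Primcodable γ] in
theorem joinString_of_extends {A : ℕ → γ} {X : ℕ → α} {Y : ℕ → β} {ρ : List α} {σ : List β}
    (hX : Extends ρ X) (hY : Extends σ Y) :
    joinString A ρ σ = initSeg (joinSeq A X Y) (min ρ.length σ.length) := by
  rw [joinSeq_initSeg, joinString]
  congr 2
  · rw [← take_initSeg X (min_le_left _ _), hX]
  · rw [← take_initSeg Y (min_le_right _ _), hY]

theorem isSemidec_not_joinString {R : List (γ × α × β) → ℕ → Prop} (hR : PrimrecRel R) :
    IsSemidec fun (Z : ℕ → γ) (x : List α × List β × ℕ) => ¬ R (joinString Z x.1 x.2.1) x.2.2 := by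
  have hmin : Primrec fun x : List α × List β × ℕ => min x.1.length x.2.1.length :=
    Primrec.nat_min.comp (Primrec.list_length.comp .fst)
      (Primrec.list_length.comp (Primrec.fst.comp .snd))
  refine ⟨fun l x => min x.1.length x.2.1.length ≤ l.length ∧
    ¬ R (pairLists (l.take (min x.1.length x.2.1.length))
      (pairLists (x.1.take (min x.1.length x.2.1.length))
        (x.2.1.take (min x.1.length x.2.1.length)))) x.2.2, ?_, fun Z x => ?_⟩
  · refine PrimrecPred.and (Primrec.nat_le.comp (hmin.comp .snd) (Primrec.list_length.comp .fst))
      (PrimrecPred.not (hR.comp (primrec_pairLists.comp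
        (Primrec.list_take.comp (hmin.comp .snd) .fst)
        (primrec_pairLists.comp (Primrec.list_take.comp (hmin.comp .snd) (Primrec.fst.comp .snd))
          (Primrec.list_take.comp (hmin.comp .snd) (Primrec.fst.comp (Primrec.snd.comp .snd)))))
        (Primrec.snd.comp (Primrec.snd.comp .snd))))
  · simp only [joinString]
    constructor
    · intro h
      refine ⟨min x.1.length x.2.1.length, by simp, ?_⟩
      rwa [take_initSeg _ le_rfl]
    · rintro ⟨n, hn, h⟩
      rw [length_initSeg] at hn
      rwa [take_initSeg _ hn] at h

/-- Low basis theorem for left-full classes: if every `X` extending `ρ₀` has a companion in a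
co-semidecidable class, then there is a member of this class, with jump computable from the jump
of the oracle, which avoids a semidecidable class only if a left-full subclass avoids it. -/
theorem exists_low_generic [Finite α] [Finite β] [Inhabited α] [Inhabited β]
    {P : (ℕ → γ × α × β) → Unit → Prop} (hP : IsSemidec P) (A : ℕ → γ) (ρ₀ : List α)
    (h : ∀ X, Extends ρ₀ X → ∃ Y, ¬ P (joinSeq A X Y) ()) :
    ∃ X Y, Extends ρ₀ X ∧ ¬ P (joinSeq A X Y) () ∧
      SetTuringLE (seqJump (joinSeq A X Y)) (seqJump A) ∧
      ∀ Q : (ℕ → γ × α × β) → Unit → Prop, IsSemidec Q → ¬ Q (joinSeq A X Y) () →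
        ∃ ρ, ρ₀ <+: ρ ∧ ∀ X', Extends ρ X' →
          ∃ Y', ¬ P (joinSeq A X' Y') () ∧ ¬ Q (joinSeq A X' Y') () := by
  obtain ⟨g₀, -, hg₀⟩ := hP.exists_jump_index
  obtain ⟨j, hj, hjJ⟩ := ((isSemidec_seqJump (γ := γ × α × β)).comp
    (Primrec.fst : Primrec (Prod.fst : ℕ × ℕ → ℕ)) |>.or
      (isSemidec_seqJump.comp Primrec.snd)).exists_jump_index
  obtain ⟨R, hRp, hm, hR⟩ := (isSemidec_seqJump (γ := γ × α × β)).exists_mono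
  let κ := List α × List β × ℕ × Bool
  -- The inadmissible successors. An admissible one extends the strings, is again a condition, and
  -- carries the flag `false` only if its strings already exhibit the convergence of the stage
  -- number.
  let S : (ℕ → γ) → ℕ × κ × κ → Prop := fun Z x =>
    ¬ IsStep j x.1 x.2.1 x.2.2 ∨
    (∃ X, Extends x.2.2.1 X ∧ ∀ Y, Extends x.2.2.2.1 Y → x.2.2.2.2.1 ∈ seqJump (joinSeq Z X Y)) ∨
    (x.2.2.2.2.2 = false ∧ ¬ R (joinString Z x.2.2.1 x.2.2.2.1) x.1)
  have hS : IsSemidec S := by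
    have hq : Primrec fun x : ℕ × κ × κ => x.2.2 := Primrec.snd.comp .snd
    have hρ : Primrec fun x : ℕ × κ × κ => x.2.2.1 := Primrec.fst.comp hq
    have hσ : Primrec fun x : ℕ × κ × κ => x.2.2.2.1 := Primrec.fst.comp (Primrec.snd.comp hq)
    have he : Primrec fun x : ℕ × κ × κ => x.2.2.2.2.1 :=
      Primrec.fst.comp (Primrec.snd.comp (Primrec.snd.comp hq))
    have hb : Primrec fun x : ℕ × κ × κ => x.2.2.2.2.2 :=
      Primrec.snd.comp (Primrec.snd.comp (Primrec.snd.comp hq))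
    refine (IsSemidec.of_primrecPred (primrecPred_isStep hj).not).or (.or ?_ (.and ?_ ?_))
    · exact (isSemidec_seqJump (γ := γ × α × β)).exists_forall_extends.comp
        (he.pair (hρ.pair hσ))
    · exact IsSemidec.of_primrecPred (Primrec.eq.comp hb (.const false))
    · exact (isSemidec_not_joinString hRp).comp (hρ.pair (hσ.pair .fst))
  have hSiff : ∀ i (p q : κ), ¬ S A (i, p, q) ↔ IsStep j i p q ∧
      LeftFullBelow A q.1 q.2.1 q.2.2.1 ∧ (q.2.2.2 = false → R (joinString A q.1 q.2.1) i) := by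
    intro i p q
    simp only [S, LeftFullBelow]
    push Not
    rfl
  have hhit : ∀ {ρ : List α} {σ : List β} {X Y} {i : ℕ}, Extends ρ X → Extends σ Y →
      R (joinString A ρ σ) i → i ∈ seqJump (joinSeq A X Y) := by
    intro ρ σ X Y i hX hY hi
    rw [joinString_of_extends hX hY] at hi
    exact (hR _ _).2 ⟨_, hi⟩
  -- The initial index is that of `P`, and indices only accumulate, so every condition keeps the
  -- companions outside `P`.
  obtain ⟨p, hp0, hInv, hstep, hcomp⟩ := exists_seq_le_seqJump hS A
    (fun _ p => LeftFullBelow A p.1 p.2.1 p.2.2.1) (ρ₀, [], g₀ (), true)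
    (fun X hX => by
      obtain ⟨Y, hY⟩ := h X hX
      exact ⟨Y, extends_nil Y, by rwa [← hg₀]⟩)
    (by
      rintro i ⟨ρ, σ, e, b⟩ hLF
      simp only [hSiff]
      by_cases hd : LeftFullBelow A ρ σ (j (e, i))
      · obtain ⟨ρ', σ', h1, h2, h3, h4, h5⟩ := hd.exists_extension i
        exact ⟨(ρ', σ', j (e, i), true), ⟨h1, h2, h3, h4, .inl ⟨rfl, rfl⟩⟩, h5, by simp⟩
      · simp only [LeftFullBelow, not_forall, not_exists, not_and, not_not] at hd
        obtain ⟨X, hX, hXJ⟩ := hd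
        -- Some X defeats the divergence of i: every Y extending σ makes e or i converge. By
        -- compactness X up to n already does this.
        obtain ⟨n, hn⟩ := exists_uniform_level_join (R := fun l => R l e ∨ R l i)
          (fun l l' hl => Or.imp (hm l l' e hl) (hm l l' i hl)) (A := A) (X := X) (σ := σ) (by
            intro Y hY
            rcases (hjJ _ _).2 (hXJ Y hY) with h | h
            · obtain ⟨n, hn⟩ := (hR _ _).1 h
              exact ⟨n, .inl hn⟩
            · obtain ⟨n, hn⟩ := (hR _ _).1 h
              exact ⟨n, .inr hn⟩)
        have hpre : ρ <+: initSeg X (max n ρ.length) := hX.prefix_initSeg (le_max_right _ _)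
        obtain ⟨ρ', σ', h1, h2, h3, h4, h5⟩ :=
          (LeftFullBelow.of_prefix hLF hpre).exists_extension (max n i)
        refine ⟨(ρ', σ', e, false), ⟨hpre.trans h1, h2, (le_max_right _ _).trans h3,
          (le_max_right _ _).trans h4, .inr ⟨rfl, rfl⟩⟩, h5, fun _ => ?_⟩
        -- Any X' below the new condition has a companion on which e diverges, hence i converges by
        -- level n; both strings are at least that long, so they show it.
        obtain ⟨X', hX'⟩ := exists_extends ρ'
        obtain ⟨Y', hY', he⟩ := h5 X' hX'
        have hX'X : ∀ k < n, X' k = X k := fun k hk =>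
          extends_initSeg_iff.1 (hX'.of_prefix h1) k (lt_max_of_lt_left hk)
        have heq : initSeg (joinSeq A X' Y') n = initSeg (joinSeq A X Y') n := by
          rw [initSeg_eq_iff]
          intro k hk
          simp only [joinSeq, hX'X k hk]
        have h6 := hn Y' (hY'.of_prefix h2)
        rw [← heq] at h6
        rcases h6 with h6 | h6
        · exact absurd ((hR _ _).2 ⟨n, h6⟩) he
        · rw [joinString_of_extends hX' hY']
          exact rel_initSeg_mono hm (le_min ((le_max_left _ _).trans h3)
            ((le_max_left _ _).trans h4)) h6)
    (fun i p q _ hq => ((hSiff i p q).1 hq).2.1)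
  have hst : ∀ i, IsStep j i (p i) (p (i + 1)) := fun i => ((hSiff _ _ _).1 (hstep i)).1
  obtain ⟨X, hX⟩ := exists_limit_of_chain (fun i => (p i).1) (fun i => (hst i).1)
    fun i => (hst i).2.2.1
  obtain ⟨Y, hY⟩ := exists_limit_of_chain (fun i => (p i).2.1) (fun i => (hst i).2.1)
    fun i => (hst i).2.2.2.1
  have hρ0 : ∀ k, ρ₀ <+: (p k).1 := by
    intro k
    induction k with
    | zero => rw [hp0]
    | succ k ih => exact ih.trans (hst k).1
  -- indices are only added to the list of divergent computations
  have hgrow : ∀ (Z : ℕ → γ × α × β) i, ∀ k ≥ i, (p i).2.2.1 ∈ seqJump Z →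
      (p k).2.2.1 ∈ seqJump Z := by
    intro Z i k hk hi
    induction k, hk using Nat.le_induction with
    | base => exact hi
    | succ k _ ih =>
      rcases (hst k).2.2.2.2 with ⟨-, he⟩ | ⟨-, he⟩
      · rw [he, ← hjJ]
        exact .inl ih
      · rwa [he]
  -- A convergence on the limit would be visible in finitely many entries. A later condition fixes
  -- these entries, and its divergent companion Y' of X shares them.
  have havoid : ∀ i, (p i).2.2.1 ∉ seqJump (joinSeq A X Y) := by
    intro i hi
    obtain ⟨n, hn⟩ := (hR _ _).1 hi
    let k := max (n + 1) i
    have hk1 : n ≤ (p k).1.length ∧ n ≤ (p k).2.1.length := by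
      obtain ⟨m, hmk⟩ : ∃ m, k = m + 1 := ⟨k - 1, by simp only [k]; omega⟩
      have := hst m
      have hnm : n ≤ m := by
        have : n + 1 ≤ k := le_max_left _ _
        omega
      rw [hmk]
      exact ⟨hnm.trans (hst m).2.2.1, hnm.trans (hst m).2.2.2.1⟩
    obtain ⟨Y', hY', he⟩ := hInv k X (hX k)
    refine he (hgrow _ i k (le_max_right _ _) ((hR _ _).2 ⟨n, ?_⟩))
    have heq : initSeg (joinSeq A X Y') n = initSeg (joinSeq A X Y) n := by
      have h1 := joinString_of_extends (A := A) (hX k) (hY k)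
      rw [joinString_of_extends (A := A) (hX k) hY'] at h1
      have h2 := congrArg (List.take n) h1
      rwa [take_initSeg _ (le_min hk1.1 hk1.2), take_initSeg _ (le_min hk1.1 hk1.2)] at h2
    rwa [heq]
  -- The number i is decided at step i, so its flag is stored in condition i + 1.
  have hjump : ∀ i, i ∈ seqJump (joinSeq A X Y) ↔ (!(p (i + 1)).2.2.2) = true := by
    intro i
    rcases (hst i).2.2.2.2 with ⟨hb, he⟩ | ⟨hb, he⟩
    · simp only [hb, Bool.not_true, Bool.false_eq_true, iff_false]
      intro hi
      refine havoid (i + 1) ?_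
      rw [he, ← hjJ]
      exact .inr hi
    · simp only [hb, Bool.not_false, iff_true]
      exact hhit (hX (i + 1)) (hY (i + 1)) (((hSiff _ _ _).1 (hstep i)).2.2 hb)
  have hinit : ∀ Z i, P Z () → (p i).2.2.1 ∈ seqJump Z := by
    intro Z i hZ
    refine hgrow Z 0 i i.zero_le ?_
    rw [hp0]
    exact (hg₀ _ _).1 hZ
  refine ⟨X, Y, (hX 0).of_prefix (hρ0 0), fun hc => havoid 0 (hinit _ 0 hc), ?_, ?_⟩
  · refine (setTuringLE_of_manyOne Primrec.succ hjump).trans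
      (hcomp (fun q => !q.2.2.2) (Primrec.not.comp (Primrec.snd.comp (Primrec.snd.comp .snd))))
  · intro Q hQ hQn
    obtain ⟨g, -, hg⟩ := hQ.exists_jump_index
    have hi : g () ∉ seqJump (joinSeq A X Y) := by rwa [← hg]
    -- The index of `Q` was treated at step `g ()`. Since the limit avoids `Q`, divergence was then
    -- added to the condition, and that condition gives the cone.
    refine ⟨(p (g () + 1)).1, hρ0 _, fun X' hX' => ?_⟩
    obtain ⟨Y', -, he⟩ := hInv (g () + 1) X' hX'
    refine ⟨Y', fun hc => he (hinit _ _ hc), fun hc => he ?_⟩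
    rcases (hst (g ())).2.2.2.2 with ⟨-, he'⟩ | ⟨hb, -⟩
    · rw [he', ← hjJ]
      exact .inr ((hg _ _).1 hc)
    · rw [hjump, hb] at hi
      simp at hi

end LowBasis

/-! ### Solving the cross-constraint problem -/

section CrossConstraintSolution

variable {γ : Type} [Primcodable γ]

theorem IsSemidec.exists_entry {f : ℕ → γ → Prop} (hf : PrimrecRel f) :
    IsSemidec fun (Z : ℕ → γ) (_ : Unit) => ∃ n, f n (Z n) := by
  classical
  -- Testing the last entry is enough, since the stage runs through all lengths; the empty string
  -- has no entry and is rejected.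
  refine ⟨fun l _ => (l[l.length - 1]?.map fun a => decide (f (l.length - 1) a)) = some true, ?_,
    fun Z _ => ?_⟩
  · have hl : Primrec fun l : List γ => l.length - 1 :=
      Primrec.nat_sub.comp Primrec.list_length (.const 1)
    have h : Primrec fun l : List γ => l[l.length - 1]?.map fun a => decide (f (l.length - 1) a) :=
      Primrec.option_map (Primrec.list_getElem?.comp .id hl)
        (PrimrecPred.decide (hf.comp (hl.comp .fst) .snd)).to₂
    exact Primrec.eq.comp (h.comp .fst) (.const _)
  · constructor
    · rintro ⟨n, hn⟩
      exact ⟨n + 1, by simp [initSeg, hn]⟩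
    · rintro ⟨n, hn⟩
      rw [OracleCode.initSeg_getElem?] at hn
      split_ifs at hn
      · exact ⟨_, by simpa using hn⟩
      · simp at hn

theorem IsSemidec.exists_initSeg {ι : Type} [Primcodable ι] {Q : (ℕ → γ) → ι → Prop}
    (hQ : IsSemidec Q) {φ : List γ → ι} (hφ : Primrec φ) :
    IsSemidec fun Z (_ : Unit) => ∃ n, Q Z (φ (initSeg Z n)) := by
  obtain ⟨R, hR, hm, hQ⟩ := hQ.exists_mono
  refine ⟨fun l _ => ∃ k ∈ List.range (l.length + 1), R l (φ (l.take k)), ?_, fun Z _ => ?_⟩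
  · exact PrimrecPred.exists_mem_list' (ι := List γ × Unit) (R := fun k p => R p.1 (φ (p.1.take k)))
      (f := fun p => List.range (p.1.length + 1))
      (Primrec.list_range.comp (Primrec.succ.comp (Primrec.list_length.comp .fst)))
      (hR.comp (Primrec.fst.comp .snd)
        (hφ.comp (Primrec.list_take.comp .fst (Primrec.fst.comp .snd))))
  · simp only [hQ]
    constructor
    · rintro ⟨n, m, h⟩
      refine ⟨max n m, n, by simp, ?_⟩
      rw [take_initSeg _ (le_max_left _ _)]
      exact rel_initSeg_mono hm (le_max_right _ _) h
    · rintro ⟨m, n, hn, h⟩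
      simp only [length_initSeg, List.mem_range] at hn
      rw [take_initSeg _ (by omega)] at h
      exact ⟨n, m, h⟩

/-- Pairs `(X, Y)` of a 3-valued sequence and a sequence of `r`-tuples of bits. -/
abbrev TupleClass (r : ℕ) : Type := (ℕ → Fin 3) → (ℕ → Fin r → Fin 2) → Prop

variable {r : ℕ}

/-- The class `C` is co-semidecidable with oracle `A`. -/
def IsCoSemidecClass (A : ℕ → γ) (C : TupleClass r) : Prop :=
  ∃ P : (ℕ → γ × Fin 3 × (Fin r → Fin 2)) → Unit → Prop, IsSemidec P ∧
    ∀ X Y, C X Y ↔ ¬ P (joinSeq A X Y) ()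

/-- Every `X` extending `ρ` is the left part of a member of `C`. -/
def LeftFullOn (C : TupleClass r) (ρ : List (Fin 3)) : Prop :=
  ∀ X, Extends ρ X → ∃ Y, C X Y

theorem LeftFullOn.of_prefix {C : TupleClass r} {ρ ρ' : List (Fin 3)} (h : LeftFullOn C ρ)
    (hρ : ρ <+: ρ') : LeftFullOn C ρ' := fun X hX => h X (hX.of_prefix hρ)

/-- The members of `C` whose `s`-th coloring is opposite to one available for each `X₁` that
extends `ρ` and then differs from `X` everywhere. -/
def oppositeClass (C : TupleClass r) (s : Fin r) (ρ : List (Fin 3)) : TupleClass r := fun X Y =>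
  C X Y ∧ ∀ X₁, Extends ρ X₁ → (∀ n, ρ.length ≤ n → X₁ n ≠ X n) →
    ∃ Y₁, C X₁ Y₁ ∧ ∀ n, ρ.length ≤ n → Y₁ n s ≠ Y n s

/-- No condition below `ρ` forces the `s`-th coloring to be opposed. -/
def Unopposed (C : TupleClass r) (ρ : List (Fin 3)) (s : Fin r) : Prop :=
  ∀ ρ₁ ρ', ρ <+: ρ₁ → ρ <+: ρ' → ¬ LeftFullOn (oppositeClass C s ρ₁) ρ'

/-- The class C occurs only positively in `oppositeClass`, so shrinking it cannot create opposition.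
Coordinates already treated therefore stay unopposed. -/
theorem Unopposed.mono {C C' : TupleClass r} {ρ ρ' : List (Fin 3)} {s : Fin r}
    (h : Unopposed C ρ s) (hC : ∀ X Y, C' X Y → C X Y) (hρ : ρ <+: ρ') : Unopposed C' ρ' s := by
  intro ρ₁ ρ₂ h1 h2 hLF
  refine h ρ₁ ρ₂ (hρ.trans h1) (hρ.trans h2) fun X hX => ?_
  obtain ⟨Y, hY, hY'⟩ := hLF X hX
  refine ⟨Y, hC _ _ hY, fun X₁ hX₁ hne => ?_⟩
  obtain ⟨Y₁, hY₁, hne'⟩ := hY' X₁ hX₁ hne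
  exact ⟨Y₁, hC _ _ hY₁, hne'⟩

theorem exists_ne_ne (a b : Fin 3) : ∃ c : Fin 3, c ≠ a ∧ c ≠ b := by
  revert a b
  decide

/-- Fix a member (X₀, Y₀) of the double restriction. Given X₂, three colors leave room for an X₁
that avoids X₀ and X₂; then Y₁ opposes Y₀, Y₂ opposes Y₁, and with two colors Y₂ equals Y₀ at s. So
w is the s-th coloring of Y₀. -/
theorem exists_constant_of_opposite_twice {C : TupleClass r} {s : Fin r}
    {ρ₁ ρ₁' ρ' : List (Fin 3)}
    (h : LeftFullOn (oppositeClass (oppositeClass C s ρ₁) s ρ₁') ρ') :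
    ∃ ρ₂ M, ∃ w : ℕ → Fin 2, ρ₁ <+: ρ₂ ∧
      LeftFullOn (fun X Y => C X Y ∧ ∀ n, M ≤ n → Y n s = w n) ρ₂ := by
  obtain ⟨X₀, hX₀⟩ := exists_extends ρ'
  obtain ⟨Y₀, -, hopp⟩ := h X₀ hX₀
  let L := max ρ₁.length ρ₁'.length
  -- X₁ must start with ρ₁', so where ρ₁' is longer than ρ₁ the string ρ₂ takes the values of ρ₁'
  -- plus one, which forces X₂ to differ from X₁ there.
  let ρ₂ := initSeg (fun n => if n < ρ₁.length then ρ₁.getD n 0 else ρ₁'.getD n 0 + 1) L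
  have hgetD : ∀ {ρ : List (Fin 3)} {X : ℕ → Fin 3}, Extends ρ X → ∀ n < ρ.length,
      X n = ρ.getD n 0 := by
    intro ρ X hX n hn
    have h1 : (initSeg X ρ.length)[n]? = some (X n) := by
      rw [OracleCode.initSeg_getElem?, if_pos hn]
    rw [hX] at h1
    simp [List.getD_eq_getElem?_getD, h1]
  have hext : ∀ {ρ : List (Fin 3)} {X : ℕ → Fin 3}, (∀ n < ρ.length, X n = ρ.getD n 0) →
      Extends ρ X := by
    intro ρ X hX
    refine List.ext_getElem (by simp) fun i h1 h2 => ?_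
    simp [initSeg, hX i h2, h2]
  have hρ₂ : ρ₁ <+: ρ₂ := by
    have h1 : Extends ρ₁ fun n => if n < ρ₁.length then ρ₁.getD n 0 else ρ₁'.getD n 0 + 1 :=
      hext fun n hn => by simp [hn]
    exact h1.prefix_initSeg (le_max_left _ _)
  refine ⟨ρ₂, L, fun n => Y₀ n s, hρ₂, fun X₂ hX₂ => ?_⟩
  choose c hc using fun n => exists_ne_ne (X₀ n) (X₂ n)
  let X₁ : ℕ → Fin 3 := fun n => if n < ρ₁'.length then ρ₁'.getD n 0 else c n
  obtain ⟨Y₁, ⟨-, hY₁⟩, hne₁⟩ := hopp X₁ (hext fun n hn => by simp [X₁, hn]) fun n hn => by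
    simp only [X₁, if_neg (not_lt.2 hn)]
    exact (hc n).1
  obtain ⟨Y₂, hY₂, hne₂⟩ := hY₁ X₂ (hX₂.of_prefix hρ₂) fun n hn => by
    by_cases hn' : n < ρ₁'.length
    · have h2 := extends_initSeg_iff.1 hX₂ n (lt_max_of_lt_right hn')
      simp only [if_neg (not_lt.2 hn)] at h2
      simp only [X₁, if_pos hn', h2]
      generalize ρ₁'.getD n 0 = a
      revert a
      decide
    · simp only [X₁, if_neg hn']
      exact (hc n).2.symm
  refine ⟨Y₂, hY₂, fun n hn => ?_⟩
  have h1 := hne₁ n ((le_max_right _ _).trans hn)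
  have h2 := hne₂ n ((le_max_left _ _).trans hn)
  change Y₂ n s = Y₀ n s
  omega

/-- The `n`-th entry of the sequence that begins with `ρ` and then follows a sequence with
`n`-th entry `x`, avoiding one with `n`-th entry `a`. -/
def avoidAt (ρ : List (Fin 3)) (n : ℕ) (a x : Fin 3) : Fin 3 :=
  if n < ρ.length then ρ.getD n 0 else if x = a then a + 1 else x

theorem primrec_avoidAt (ρ : List (Fin 3)) :
    Primrec fun p : ℕ × Fin 3 × Fin 3 => avoidAt ρ p.1 p.2.1 p.2.2 :=
  Primrec.ite (Primrec.nat_lt.comp .fst (.const _)) ((Primrec.list_getD 0).comp (.const ρ) .fst)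
    ((Primrec.dom_finite fun p : Fin 3 × Fin 3 => if p.2 = p.1 then p.1 + 1 else p.2).comp .snd)

theorem avoidAt_ne {ρ : List (Fin 3)} {n : ℕ} (hn : ρ.length ≤ n) (a x : Fin 3) :
    avoidAt ρ n a x ≠ a := by
  simp only [avoidAt, if_neg (not_lt.2 hn)]
  split_ifs with h
  · clear h
    revert a
    decide
  · exact h

theorem extends_avoidAt (ρ : List (Fin 3)) (X x : ℕ → Fin 3) :
    Extends ρ fun n => avoidAt ρ n (X n) (x n) := by
  refine List.ext_getElem (by simp) fun i h1 h2 => ?_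
  simp [initSeg, avoidAt, h2]

/-- Every sequence that extends ρ and then avoids X arises from a parameter, namely from itself.
Quantifiers over such sequences thus become quantifiers over all of 3^ℕ. -/
theorem avoidAt_eq {ρ : List (Fin 3)} {X X₁ : ℕ → Fin 3} (h : Extends ρ X₁)
    (hne : ∀ n, ρ.length ≤ n → X₁ n ≠ X n) (n : ℕ) : avoidAt ρ n (X n) (X₁ n) = X₁ n := by
  unfold avoidAt
  split_ifs with h1 h2
  · have h3 : (initSeg X₁ ρ.length)[n]? = some (X₁ n) := by
      rw [OracleCode.initSeg_getElem?, if_pos h1]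
    rw [h] at h3
    simp [List.getD_eq_getElem?_getD, h3]
  · exact absurd h2 (hne n (not_lt.1 h1))
  · rfl

theorem primrecRel_coord (m : ℕ) (p : (Fin r → Fin 2) → (Fin r → Fin 2) → Prop) :
    PrimrecRel fun (n : ℕ) (z : (γ × Fin 3 × (Fin r → Fin 2)) × Fin 3 × (Fin r → Fin 2)) =>
      m ≤ n ∧ p z.2.2 z.1.2.2 := by
  classical
  refine PrimrecPred.and (Primrec.nat_le.comp (.const m) .fst) ?_
  have h : PrimrecPred fun q : (Fin r → Fin 2) × (Fin r → Fin 2) => p q.1 q.2 :=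
    Primrec.primrecPred (Primrec.dom_finite _)
  exact h.comp ((Primrec.snd.comp (Primrec.snd.comp .snd)).pair
    (Primrec.snd.comp (Primrec.snd.comp (Primrec.fst.comp .snd))))

/-- Applies a predicate of (A, X₁, Y₁) to the join of (A, X₀, Y₀) with (x, Y₁), where X₁ is computed
entrywise from X₀ and x. -/
theorem IsSemidec.comp_drop_middle {P : (ℕ → γ × Fin 3 × (Fin r → Fin 2)) → Unit → Prop}
    (hP : IsSemidec P) {f : ℕ → Fin 3 → Fin 3 → Fin 3}
    (hf : Primrec fun p : ℕ × Fin 3 × Fin 3 => f p.1 p.2.1 p.2.2) :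
    IsSemidec fun (Z : ℕ → (γ × Fin 3 × (Fin r → Fin 2)) × Fin 3 × (Fin r → Fin 2)) b =>
      P (fun n => ((Z n).1.1, f n (Z n).1.2.1 (Z n).2.1, (Z n).2.2)) b :=
  hP.comp_pointwise (f := fun n (z : (γ × Fin 3 × (Fin r → Fin 2)) × Fin 3 × (Fin r → Fin 2)) =>
      (z.1.1, f n z.1.2.1 z.2.1, z.2.2))
    ((Primrec.fst.comp (Primrec.fst.comp .snd)).pair
      ((hf.comp (Primrec.fst.pair ((Primrec.fst.comp (Primrec.snd.comp (Primrec.fst.comp .snd))).pair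
        (Primrec.fst.comp (Primrec.snd.comp .snd))))).pair
        (Primrec.snd.comp (Primrec.snd.comp .snd))))

theorem IsSemidec.exists_forall {P : (ℕ → γ × Fin 3 × (Fin r → Fin 2)) → Unit → Prop}
    (hP : IsSemidec P) (ρ : List (Fin 3)) :
    IsSemidec fun A (_ : Unit) => ∃ X, Extends ρ X ∧ ∀ Y, P (joinSeq A X Y) () := by
  have := (hP.exists_forall_extends).comp (f := fun _ : Unit => ((), ρ, ([] : List (Fin r → Fin 2))))
    (.const _)
  exact this.of_iff fun A _ => by simp

/-- After the parametrization by `avoidAt`, the negation of the opposing condition has the form ∃ x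
∀ Y₁ with a semidecidable matrix, which compactness keeps semidecidable. -/
theorem IsCoSemidecClass.oppositeClass {A : ℕ → γ} {C : TupleClass r} (h : IsCoSemidecClass A C)
    (s : Fin r) (ρ : List (Fin 3)) : IsCoSemidecClass A (oppositeClass C s ρ) := by
  obtain ⟨P, hP, hC⟩ := h
  have h1 := (hP.comp_drop_middle (primrec_avoidAt ρ)).or
    (IsSemidec.exists_entry (primrecRel_coord (γ := γ) ρ.length fun y y' => y s = y' s))
  refine ⟨_, hP.or (h1.exists_forall []), fun X Y => ?_⟩
  simp only [extends_nil, true_and, _root_.oppositeClass, hC]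
  push Not
  refine and_congr_right fun _ => ?_
  constructor
  · intro h x
    obtain ⟨Y₁, hY₁, hne⟩ := h _ (extends_avoidAt ρ X x) fun n hn => avoidAt_ne hn _ _
    exact ⟨Y₁, hY₁, hne⟩
  · intro h X₁ hX₁ hne
    obtain ⟨Y₁, hY₁, hne'⟩ := h X₁
    refine ⟨Y₁, ?_, hne'⟩
    simp only [joinSeq, avoidAt_eq hX₁ hne] at hY₁
    exact hY₁

/-- Coordinates are treated one by one. If s can be opposed, pass to the opposite class; opposing it
again would freeze s by `exists_constant_of_opposite_twice`, which `hU` forbids. -/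
theorem exists_unopposed {A : ℕ → γ} {C : TupleClass r} (hC : IsCoSemidecClass A C)
    {ρ₀ : List (Fin 3)} (hLF : LeftFullOn C ρ₀) (U : Finset (Fin r))
    (hU : ∀ s ∈ U, ∀ ρ M, ∀ w : ℕ → Fin 2, ρ₀ <+: ρ →
      ¬ LeftFullOn (fun X Y => C X Y ∧ ∀ n, M ≤ n → Y n s = w n) ρ) :
    ∃ C' ρ, IsCoSemidecClass A C' ∧ (∀ X Y, C' X Y → C X Y) ∧ ρ₀ <+: ρ ∧ LeftFullOn C' ρ ∧
      ∀ s ∈ U, Unopposed C' ρ s := by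
  classical
  induction U using Finset.induction_on with
  | empty => exact ⟨C, ρ₀, hC, fun _ _ h => h, List.prefix_rfl, hLF, by simp⟩
  | insert s U _ ih =>
    obtain ⟨C', ρ, h1, h2, h3, h4, h5⟩ :=
      ih fun s' hs' => hU s' (Finset.mem_insert_of_mem hs')
    by_cases hs : Unopposed C' ρ s
    · refine ⟨C', ρ, h1, h2, h3, h4, fun s' hs' => ?_⟩
      rcases Finset.mem_insert.1 hs' with rfl | hs'
      · exact hs
      · exact h5 s' hs'
    · simp only [Unopposed, not_forall, not_not] at hs
      obtain ⟨ρ₁, ρ', hρ₁, hρ', hD⟩ := hs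
      refine ⟨oppositeClass C' s ρ₁, ρ', h1.oppositeClass s ρ₁, fun X Y h => h2 _ _ h.1,
        h3.trans hρ', hD, fun s' hs' => ?_⟩
      rcases Finset.mem_insert.1 hs' with rfl | hs'
      · intro ρ₁' ρ'' _ _ hDD
        obtain ⟨ρ₂, M, w, hρ₂, hw⟩ := exists_constant_of_opposite_twice hDD
        refine hU s' hs' ρ₂ M w (h3.trans (hρ₁.trans hρ₂)) fun X hX => ?_
        obtain ⟨Y, hY, hY'⟩ := hw X hX
        exact ⟨Y, h2 _ _ hY, hY'⟩
      · exact (h5 s' hs').mono (fun X Y h => h.1) hρ'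

/-- In an unopposed class there are two members, low over the oracle, whose left parts are
finitely compatible and whose right parts are infinitely compatible. -/
theorem exists_compatible_of_unopposed {A : ℕ → γ} {C : TupleClass r}
    (hC : IsCoSemidecClass A C) {ρ₀ : List (Fin 3)} (hLF : LeftFullOn C ρ₀) {U : Finset (Fin r)}
    (hU : ∀ s ∈ U, Unopposed C ρ₀ s) :
    ∃ X₀ Y₀ x Y₁, C X₀ Y₀ ∧ C (fun n => avoidAt ρ₀ n (X₀ n) (x n)) Y₁ ∧
      (∀ s ∈ U, ∀ m, ∃ n, m ≤ n ∧ Y₁ n s = Y₀ n s) ∧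
      SetTuringLE (seqJump (joinSeq (joinSeq A X₀ Y₀) x Y₁)) (seqJump A) := by
  have hC' := hC
  obtain ⟨P, hP, hCP⟩ := hC
  obtain ⟨X₀, Y₀, -, hPX, hlow, hgen⟩ := exists_low_generic hP A ρ₀ fun X hX => by
    obtain ⟨Y, hY⟩ := hLF X hX
    exact ⟨Y, (hCP _ _).1 hY⟩
  -- Otherwise (X₀, Y₀) lies in the opposite class, and genericity makes that class left-full below
  -- some ρ, against unopposedness.
  have hagree : ∀ s ∈ U, ∀ ρ₁, ρ₀ <+: ρ₁ → ∃ X₁, Extends ρ₁ X₁ ∧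
      (∀ n, ρ₁.length ≤ n → X₁ n ≠ X₀ n) ∧
      ∀ Y₁, C X₁ Y₁ → ∃ n, ρ₁.length ≤ n ∧ Y₁ n s = Y₀ n s := by
    intro s hs ρ₁ hρ₁
    by_contra! hcon
    obtain ⟨Q, hQ, hDQ⟩ := hC'.oppositeClass s ρ₁
    obtain ⟨ρ, hρ, hX'⟩ := hgen Q hQ ((hDQ _ _).1 ⟨(hCP _ _).2 hPX, hcon⟩)
    refine hU s hs ρ₁ ρ hρ₁ hρ fun X hX => ?_
    obtain ⟨Y, -, hY⟩ := hX' X hX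
    exact ⟨Y, (hDQ _ _).2 hY⟩
  -- The second member is generic over the first. Its left part is given by a parameter x ranging
  -- over all sequences, so that left-fullness is inherited.
  obtain ⟨x, Y₁, -, hPx, hlow', hgen'⟩ := exists_low_generic
    (hP.comp_drop_middle (primrec_avoidAt ρ₀)) (joinSeq A X₀ Y₀) [] fun x _ => by
      obtain ⟨Y, hY⟩ := hLF _ (extends_avoidAt ρ₀ X₀ x)
      exact ⟨Y, (hCP _ _).1 hY⟩
  refine ⟨X₀, Y₀, x, Y₁, (hCP _ _).2 hPX, (hCP _ _).2 hPx, fun s hs m => ?_, hlow'.trans hlow⟩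
  by_contra hcon
  obtain ⟨ρ, -, hρ⟩ := hgen' _
    (IsSemidec.exists_entry (primrecRel_coord (γ := γ) m fun y y' => y s = y' s)) hcon
  obtain ⟨z, hz⟩ := exists_extends ρ
  -- Long enough to extend ρ₀, to let the parameter of X₁ begin with ρ, and to place the agreement
  -- found past |ρ₁| also past m.
  let ρ₁ := initSeg (fun n => avoidAt ρ₀ n (X₀ n) (z n)) (max m (max ρ.length ρ₀.length))
  have hlen : ρ₁.length = max m (max ρ.length ρ₀.length) := by simp [ρ₁]
  have hρ₁ : ρ₀ <+: ρ₁ := (extends_avoidAt ρ₀ X₀ z).prefix_initSeg (by simp)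
  obtain ⟨X₁, hX₁, hne, hX₁Y⟩ := hagree s hs ρ₁ hρ₁
  -- the parameter whose sequence is `X₁`
  let x' : ℕ → Fin 3 := fun n => if n < ρ₁.length then z n else X₁ n
  have hx' : ∀ n, avoidAt ρ₀ n (X₀ n) (x' n) = X₁ n := by
    intro n
    by_cases hn : n < ρ₁.length
    · simp only [x', if_pos hn]
      rw [hlen] at hn
      exact (extends_initSeg_iff.1 hX₁ n hn).symm
    · have hn' : ρ₀.length ≤ n := hρ₁.length_le.trans (not_lt.1 hn)
      simp only [x', if_neg hn, avoidAt, if_neg (not_lt.2 hn'), if_neg (hne n (not_lt.1 hn))]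
  have hρx' : Extends ρ x' := by
    refine hz.of_initSeg_eq (n := ρ₁.length) (by simp [hlen]) fun n hn => ?_
    simp only [x', if_pos hn]
  obtain ⟨Y, hPY, hY⟩ := hρ x' hρx'
  have hCY : C X₁ Y := by
    rw [hCP]
    simp only [joinSeq, hx'] at hPY
    exact hPY
  obtain ⟨n, hn, he⟩ := hX₁Y Y hCY
  refine hY ⟨n, ?_, he⟩
  rw [hlen] at hn
  exact (le_max_left _ _).trans hn

end CrossConstraintSolution

/-! ### Frozen coordinates and low solutions of cross-trees -/

section CrossConstraintSolution

variable {r : ℕ}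

theorem encode_mem_codeSet {α : Type} [Primcodable α] {S : Set α} {a : α} :
    Encodable.encode a ∈ codeSet S ↔ a ∈ S := by
  constructor
  · rintro ⟨b, hb, he⟩
    rwa [← Encodable.encode_injective he]
  · exact fun h => ⟨a, h, rfl⟩

/-- The paths of a cross-tree as a class of pairs of sequences. -/
def pathClass (T : Set (CrossString r)) : TupleClass r := fun X Y =>
  (X, fun s n => Y n s) ∈ crossPaths T

theorem isCoSemidecClass_pathClass {T : Set (CrossString r)} {A : Set ℕ}
    (h : SetTuringLE (codeSet T) A) : IsCoSemidecClass (charSeq A) (pathClass T) := by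
  obtain ⟨-, Q, -, hQ, -, hTQ⟩ := h.exists_semidec
  let φ : List (Bool × Fin 3 × (Fin r → Fin 2)) → CrossString r := fun l =>
    (l.map fun z => z.2.1, fun s => l.map fun z => z.2.2 s)
  have hφ : Primrec φ := by
    refine (Primrec.list_map .id (Primrec.fst.comp (Primrec.snd.comp .snd)).to₂).pair ?_
    refine Primrec.fin_curry.2 (Primrec.list_map .fst ?_)
    exact (Primrec.fin_app.comp (Primrec.snd.comp (Primrec.snd.comp .snd))
      (Primrec.snd.comp .fst)).to₂
  have h1 : IsSemidec fun (Z : ℕ → Bool × Fin 3 × (Fin r → Fin 2)) n =>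
      Q (fun n => (Z n).1) n := hQ.comp_pointwise (Primrec.fst.comp .snd).to₂
  refine ⟨_, h1.exists_initSeg (Primrec.encode.comp hφ), fun X Y => ?_⟩
  push Not
  refine forall_congr' fun n => ?_
  refine Iff.trans ?_ (not_congr (hTQ (Encodable.encode (self := Primcodable.toEncodable)
    (φ (initSeg (joinSeq (charSeq A) X Y) n)))))
  rw [not_not]
  have h2 : φ (initSeg (joinSeq (charSeq A) X Y) n) =
      (initSeg X n, fun s => initSeg (fun n => Y n s) n) := by
    simp [φ, initSeg, joinSeq, Function.comp_def]
  rw [h2]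
  exact encode_mem_codeSet.symm

theorem leftFullOn_pathClass {T : Set (CrossString r)} (hT : IsLeftFull T) :
    LeftFullOn (pathClass T) [] := by
  intro X _
  obtain ⟨Y, hY⟩ := hT X
  exact ⟨fun n s => Y s n, hY⟩

/-- The members of a class whose colorings in `S` agree with `w` from `m` on. -/
def agreeingClass (C : TupleClass r) (S : Finset (Fin r)) (m : ℕ) (w : ℕ → Fin r → Fin 2) :
    TupleClass r := fun X Y => C X Y ∧ ∀ n, m ≤ n → ∀ s ∈ S, Y n s = w n s

/-- Uniformity in w is the point: w belongs to the oracle, so the low basis theorem can afterwards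
be used to choose w itself. -/
theorem isSemidec_not_agreeing {γ : Type} [Primcodable γ]
    {P : (ℕ → γ × Fin 3 × (Fin r → Fin 2)) → Unit → Prop} (hP : IsSemidec P)
    (S : Finset (Fin r)) (m : ℕ) :
    ∃ Q : (ℕ → (γ × Fin 3 × (Fin r → Fin 2)) × Fin 3 × (Fin r → Fin 2)) → Unit → Prop,
      IsSemidec Q ∧ ∀ (A : ℕ → γ) x w X Y, ¬ Q (joinSeq (joinSeq A x w) X Y) () ↔
        agreeingClass (fun X Y => ¬ P (joinSeq A X Y) ()) S m w X Y := by
  refine ⟨_, (hP.comp_drop_middle (f := fun _ _ b => b) (Primrec.snd.comp .snd)).or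
    (IsSemidec.exists_entry (primrecRel_coord (γ := γ) m fun y y' => ∃ s ∈ S, y s ≠ y' s)),
    fun A x w X Y => ?_⟩
  simp only [agreeingClass]
  push Not
  exact Iff.rfl

/-- A left-full class contains, for a low `w`, a left-full class of pairs whose colorings in a
maximal set agree with `w`. -/
theorem exists_maximal_agreeing {γ : Type} [Primcodable γ] {A : ℕ → γ} {C : TupleClass r}
    (hC : IsCoSemidecClass A C) (hLF : LeftFullOn C []) :
    ∃ (S : Finset (Fin r)) (ρ : List (Fin 3)) (m : ℕ) (x : ℕ → Fin 3) (w : ℕ → Fin r → Fin 2),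
      LeftFullOn (agreeingClass C S m w) ρ ∧
      IsCoSemidecClass (joinSeq A x w) (agreeingClass C S m w) ∧
      SetTuringLE (seqJump (joinSeq A x w)) (seqJump A) ∧
      ∀ s ∉ S, ∀ ρ' M, ∀ v : ℕ → Fin 2, ρ <+: ρ' →
        ¬ LeftFullOn (fun X Y => agreeingClass C S m w X Y ∧ ∀ n, M ≤ n → Y n s = v n) ρ' := by
  classical
  let F : Finset (Finset (Fin r)) := Finset.univ.filter fun S =>
    ∃ ρ m w, LeftFullOn (agreeingClass C S m w) ρ
  have hF : F.Nonempty := by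
    refine ⟨∅, ?_⟩
    simp only [F, Finset.mem_filter, Finset.mem_univ, true_and]
    refine ⟨[], 0, fun _ _ => 0, fun X hX => ?_⟩
    obtain ⟨Y, hY⟩ := hLF X hX
    exact ⟨Y, hY, by simp⟩
  obtain ⟨S, hS, hmax⟩ := F.exists_max_image Finset.card hF
  simp only [F, Finset.mem_filter, Finset.mem_univ, true_and] at hS hmax
  obtain ⟨ρ, m, w₀, hw₀⟩ := hS
  obtain ⟨P, hP, hCP⟩ := hC
  have hCeq : C = fun X Y => ¬ P (joinSeq A X Y) () := by
    funext X Y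
    exact propext (hCP X Y)
  obtain ⟨Q, hQ, hQS⟩ := isSemidec_not_agreeing hP S m
  have hLFQ : ∀ x w, (¬ ∃ X, Extends ρ X ∧ ∀ Y, Q (joinSeq (joinSeq A x w) X Y) ()) ↔
      LeftFullOn (agreeingClass C S m w) ρ := by
    intro x w
    simp only [LeftFullOn, hCeq, ← hQS A x w]
    push Not
    rfl
  -- Here w plays the role of the companion and w₀ serves for every left part; x is mere padding.
  obtain ⟨x, w, -, hw, hlow, -⟩ := exists_low_generic (hQ.exists_forall ρ) A []
    fun X _ => ⟨w₀, (hLFQ X w₀).2 hw₀⟩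
  refine ⟨S, ρ, m, x, w, (hLFQ x w).1 hw, ⟨Q, hQ, fun X Y => ?_⟩, hlow, ?_⟩
  · rw [hQS, hCeq]
  · intro s hs ρ' M v _ hcon
    -- If s could also be frozen to v, then w with its s-th coordinate replaced by v would freeze
    -- the larger set `insert s S`.
    have h1 := hmax (insert s S) ⟨ρ', max m M, fun n i => if i = s then v n else w n i,
      fun X hX => by
        obtain ⟨Y, ⟨hY, hYw⟩, hYv⟩ := hcon X hX
        refine ⟨Y, hY, fun n hn i hi => ?_⟩
        by_cases his : i = s
        · subst his
          simpa using hYv n ((le_max_right _ _).trans hn)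
        · simpa [his] using hYw n ((le_max_left _ _).trans hn) i (Finset.mem_of_mem_insert_of_ne hi his)⟩
    rw [Finset.card_insert_of_notMem hs] at h1
    omega

theorem infinitelyCompatible_of_frequently {k : ℕ} {f g : ℕ → Fin k}
    (h : ∀ m, ∃ n, m ≤ n ∧ f n = g n) : InfinitelyCompatible f g := by
  intro hfin
  have h1 : (⋃ i, f ⁻¹' {i} ∩ g ⁻¹' {i}).Finite := Set.finite_iUnion hfin
  obtain ⟨m, hm⟩ := h1.bddAbove
  obtain ⟨n, hn, he⟩ := h (m + 1)
  have h2 : n ≤ m := hm (Set.mem_iUnion.2 ⟨g n, by simp [he]⟩)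
  omega

theorem finitelyCompatible_of_eventually {k : ℕ} {f g : ℕ → Fin k} (m : ℕ)
    (h : ∀ n, m ≤ n → f n ≠ g n) : FinitelyCompatible f g := by
  intro i
  refine (Set.finite_lt_nat m).subset fun n hn => ?_
  by_contra hc
  exact h n (not_lt.1 hc) (hn.1.trans hn.2.symm)

theorem seqSet_eq_seqGraph (X : ℕ → Fin 3) (Y : ℕ → Fin r → Fin 2) :
    seqSet ((X, fun s n => Y n s) : CrossSeq r) = seqGraph fun n => (X n, Y n) := by
  ext k
  constructor
  · rintro ⟨⟨n, p⟩, hp, rfl⟩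
    exact ⟨n, by rw [show p = (X n, Y n) from hp]⟩
  · rintro ⟨n, rfl⟩
    exact ⟨(n, X n, Y n), rfl, rfl⟩

section Join

variable {α β γ : Type} [Primcodable α] [Primcodable β] [Primcodable γ]

theorem seqGraph_le_joinSeq (Z : ℕ → γ) (X : ℕ → α) (Y : ℕ → β) :
    SetTuringLE (seqGraph Z) (seqGraph (joinSeq Z X Y)) :=
  seqGraph_comp_le (Z := joinSeq Z X Y) (f := fun _ z => z.1) (Primrec.fst.comp .snd).to₂

theorem seqGraph_pair_le_joinSeq (Z : ℕ → γ) (X : ℕ → α) (Y : ℕ → β) :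
    SetTuringLE (seqGraph fun n => (X n, Y n)) (seqGraph (joinSeq Z X Y)) :=
  seqGraph_comp_le (Z := joinSeq Z X Y) (f := fun _ z => z.2) (Primrec.snd.comp .snd).to₂

theorem seqGraph_avoidAt_le (ρ : List (Fin 3)) (A : ℕ → γ) (X x : ℕ → Fin 3) (Y Y' : ℕ → β) :
    SetTuringLE (seqGraph fun n => (avoidAt ρ n (X n) (x n), Y' n))
      (seqGraph (joinSeq (joinSeq A X Y) x Y')) :=
  seqGraph_comp_le (Z := joinSeq (joinSeq A X Y) x Y')
    (f := fun n z => (avoidAt ρ n z.1.2.1 z.2.1, z.2.2))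
    (((primrec_avoidAt ρ).comp (Primrec.fst.pair
      ((Primrec.fst.comp (Primrec.snd.comp (Primrec.fst.comp .snd))).pair
        (Primrec.fst.comp (Primrec.snd.comp .snd))))).pair
      (Primrec.snd.comp (Primrec.snd.comp .snd))).to₂

theorem setTuringLE_seqGraph_charSeq (A : Set ℕ) : SetTuringLE A (seqGraph (charSeq A)) :=
  setTuringLE_of_semidec (isSemidec_bit true) (isSemidec_bit false)
    (fun _ => charSeq_eq_true.symm) fun n => by rw [← charSeq_eq_true, Bool.not_eq_true]

end Join

/-- Every instance of the cross-constraint problem computable from `A` has a solution computable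
from some `B` above `A` whose jump is computable from the jump of `A`. -/
theorem exists_low_solution {T : Set (CrossString r)} (hT : IsCCInstance T) {A : Set ℕ}
    (hA : SetTuringLE (codeSet T) A) :
    ∃ (P Q : CrossSeq r) (B : Set ℕ), IsCCSolution T P Q ∧ SetTuringLE A B ∧
      SetTuringLE (setJoin (seqSet P) (seqSet Q)) B ∧
      SetTuringLE (turingJump B) (turingJump A) := by
  classical
  obtain ⟨S, ρ₀, m, z, w, hLF, hC, hlow, hmax⟩ :=
    exists_maximal_agreeing (isCoSemidecClass_pathClass hA) (leftFullOn_pathClass hT.leftFull)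
  obtain ⟨C', ρ, hC', hsub, -, hLF', hun⟩ := exists_unopposed hC hLF Sᶜ
    fun s hs => hmax s (by simpa using hs)
  obtain ⟨X₀, Y₀, x, Y₁, h0, h1, hagree, hlow'⟩ := exists_compatible_of_unopposed hC' hLF' hun
  have hp0 := hsub _ _ h0
  have hp1 := hsub _ _ h1
  refine ⟨(X₀, fun s n => Y₀ n s),
    ((fun n => avoidAt ρ n (X₀ n) (x n)), fun s n => Y₁ n s),
    seqGraph (joinSeq (joinSeq (joinSeq (charSeq A) z w) X₀ Y₀) x Y₁),
    ⟨hp0.1, hp1.1, ?_, fun s => ?_⟩, ?_, ?_, ?_⟩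
  · exact finitelyCompatible_of_eventually ρ.length fun n hn => (avoidAt_ne hn _ _).symm
  · refine infinitelyCompatible_of_frequently fun k => ?_
    by_cases hs : s ∈ S
    · refine ⟨max m k, le_max_right _ _, ?_⟩
      exact (hp0.2 _ (le_max_left _ _) s hs).trans (hp1.2 _ (le_max_left _ _) s hs).symm
    · obtain ⟨n, hn, he⟩ := hagree s (by simpa using hs) k
      exact ⟨n, hn, he.symm⟩
  · exact (setTuringLE_seqGraph_charSeq A).trans <| (seqGraph_le_joinSeq _ _ _).trans <|
      (seqGraph_le_joinSeq _ _ _).trans (seqGraph_le_joinSeq _ _ _)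
  · rw [seqSet_eq_seqGraph, seqSet_eq_seqGraph]
    exact setTuringLE_setJoin ((seqGraph_pair_le_joinSeq _ _ _).trans (seqGraph_le_joinSeq _ _ _))
      (seqGraph_avoidAt_le _ _ _ _ _ _)
  · exact (hlow'.trans hlow).trans (seqJump_charSeq_le A)

/-! ### A cross-constraint ideal of low sets -/

theorem IsLow.of_le {A B : Set ℕ} (hB : IsLow B) (h : SetTuringLE A B) : IsLow A :=
  h.turingJump.trans hB

theorem setTuringLE_codeSet_empty {α : Type} [Primcodable α] {T : Set α}
    (h : ComputablePred fun χ => χ ∈ T) : SetTuringLE (codeSet T) ∅ := by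
  classical
  obtain ⟨_, hc⟩ := h
  have hf : Computable fun n : ℕ =>
      ((Encodable.decode₂ (α) n).map fun χ => decide (χ ∈ T)).getD false :=
    Computable.option_getD (Computable.option_map Primrec.decode₂.to_comp
      ((hc.comp Computable.snd).of_eq fun p => by congr).to₂) (Computable.const false)
  have hg : Computable fun n : ℕ => cond (((Encodable.decode₂ (α) n).map
      fun χ => decide (χ ∈ T)).getD false) 1 0 :=
    Computable.cond hf (Computable.const 1) (Computable.const 0)
  rw [setTuringLE_iff]
  refine (Nat.Partrec.recursiveIn (Partrec.nat_iff.1 hg)).of_eq fun n => ?_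
  have hmem : n ∈ codeSet T ↔ ((Encodable.decode₂ (α) n).map
      fun χ => decide (χ ∈ T)).getD false = true := by
    cases hd : Encodable.decode₂ (α) n with
    | none =>
      simp only [Option.map_none, Option.getD_none, Bool.false_eq_true, iff_false]
      rintro ⟨χ, -, hχ⟩
      rw [← Encodable.mem_decode₂, hd] at hχ
      cases hχ
    | some χ =>
      have hχ : Encodable.encode χ = n := Encodable.mem_decode₂.1 hd
      simp only [Option.map_some, Option.getD_some, decide_eq_true_eq]
      constructor
      · rintro ⟨χ', hχ', he⟩
        rwa [← Encodable.encode_injective (he.trans hχ.symm)]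
      · exact fun h => ⟨χ, h, hχ⟩
  rw [charFun]
  by_cases hn : n ∈ codeSet T
  · simp [hmem.1 hn, hn]
  · have := mt hmem.2 hn
    rw [Bool.not_eq_true] at this
    simp [this, hn]

theorem codeSet_injective {α : Type} [Primcodable α] :
    Function.Injective (codeSet : Set α → Set ℕ) := by
  intro S S' hS
  ext a
  rw [← encode_mem_codeSet, hS, encode_mem_codeSet]

theorem charFun_injective : Function.Injective charFun := by
  intro A B h
  ext n
  have h1 := congrFun h n
  rw [charFun_eq, charFun_eq, Part.some_inj] at h1
  rw [← charSeq_eq_true, ← charSeq_eq_true]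
  cases hA : charSeq A n <;> cases hB : charSeq B n <;> simp_all

/-- The subsets of a type with codes computable from a given set can be enumerated. -/
theorem exists_enumeration {α : Type} [Primcodable α] (A : Set ℕ) :
    ∃ E : ℕ → Set α, ∀ T, SetTuringLE (codeSet T) A → ∃ n, E n = T := by
  classical
  -- Indices that compute no characteristic function of a code set get the value ∅. The enumeration
  -- need not be effective, since only the jump at each single step of the chain matters.
  refine ⟨fun n => if h : ∃ T : Set α, charFun (codeSet T) =
    OracleCode.eval (charFun A) (OracleCode.ofIndex n) then h.choose else ∅, fun T hT => ?_⟩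
  obtain ⟨c, hc⟩ := (OracleCode.recursiveIn_iff_exists_eval _ _).1 (setTuringLE_iff.1 hT)
  have h : ∃ T : Set α, charFun (codeSet T) =
      OracleCode.eval (charFun A) (OracleCode.ofIndex c.index) :=
    ⟨T, by rw [OracleCode.ofIndex_index, hc]⟩
  refine ⟨c.index, ?_⟩
  simp only [dif_pos h]
  refine codeSet_injective (charFun_injective ?_)
  rw [h.choose_spec, OracleCode.ofIndex_index, hc]

/-- Total in T: if T is not an instance computable from A, then B is A. The chain can thus run
through an arbitrary enumeration. -/
theorem exists_next (A : Set ℕ) (T : Set (CrossString r)) :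
    ∃ B, SetTuringLE A B ∧ SetTuringLE (turingJump B) (turingJump A) ∧
      (IsCCInstance T → SetTuringLE (codeSet T) A → ∃ P Q : CrossSeq r,
        IsCCSolution T P Q ∧ SetTuringLE (setJoin (seqSet P) (seqSet Q)) B) := by
  by_cases h : IsCCInstance T ∧ SetTuringLE (codeSet T) A
  · obtain ⟨P, Q, B, h1, h2, h3, h4⟩ := exists_low_solution h.1 h.2
    exact ⟨B, h2, h4, fun _ _ => ⟨P, Q, h1, h3⟩⟩
  · exact ⟨A, setTuringLE_refl A, setTuringLE_refl _, fun h1 h2 => absurd ⟨h1, h2⟩ h⟩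

/-- An increasing sequence of low sets. The `k`-th step solves the instance with number
`k.unpair.2` among those computable from the set with number `k.unpair.1`. -/
noncomputable def lowChain (r : ℕ) : ℕ → Set ℕ
  | 0 => ∅
  | k + 1 => (exists_next (lowChain r k) ((exists_enumeration (α := CrossString r)
      (lowChain r k.unpair.1)).choose k.unpair.2)).choose
  decreasing_by
  · exact Nat.lt_succ_self k
  · exact Nat.lt_succ_of_le (Nat.unpair_left_le k)

theorem lowChain_succ (r k : ℕ) : SetTuringLE (lowChain r k) (lowChain r (k + 1)) ∧
    SetTuringLE (turingJump (lowChain r (k + 1))) (turingJump (lowChain r k)) := by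
  rw [lowChain]
  exact ⟨(exists_next _ _).choose_spec.1, (exists_next _ _).choose_spec.2.1⟩

theorem lowChain_mono (r : ℕ) {k m : ℕ} (h : k ≤ m) :
    SetTuringLE (lowChain r k) (lowChain r m) := by
  induction m, h using Nat.le_induction with
  | base => exact setTuringLE_refl _
  | succ m _ ih => exact ih.trans (lowChain_succ r m).1

theorem isLow_lowChain (r k : ℕ) : IsLow (lowChain r k) := by
  induction k with
  | zero => rw [lowChain]; exact setTuringLE_refl _
  | succ k ih => exact (lowChain_succ r k).2.trans ih

theorem lowChain_solution {T : Set (CrossString r)} (hT : IsCCInstance T) {k : ℕ}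
    (h : SetTuringLE (codeSet T) (lowChain r k)) : ∃ (m : ℕ) (P Q : CrossSeq r),
      IsCCSolution T P Q ∧ SetTuringLE (setJoin (seqSet P) (seqSet Q)) (lowChain r m) := by
  obtain ⟨n, hn⟩ := (exists_enumeration (α := CrossString r) (lowChain r k)).choose_spec T h
  -- Stage `Nat.pair k n` treats the n-th set computable from member k. It is not before k, so T is
  -- computable from the current member.
  obtain ⟨P, Q, h1, h2⟩ := (exists_next (lowChain r (Nat.pair k n))
    ((exists_enumeration (α := CrossString r) (lowChain r (Nat.pair k n).unpair.1)).choose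
      (Nat.pair k n).unpair.2)).choose_spec.2.2
    (by rwa [Nat.unpair_pair, hn])
    (by
      rw [Nat.unpair_pair, hn]
      exact h.trans (lowChain_mono r (Nat.left_le_pair k n)))
  refine ⟨Nat.pair k n + 1, P, Q, ?_, ?_⟩
  · rwa [Nat.unpair_pair, hn] at h1
  · rwa [lowChain]

end CrossConstraintSolution

theorem mainTheorem6 (r : ℕ) :
    (∀ T : Set (CrossString r), IsCCInstance T → ComputablePred (fun χ => χ ∈ T) →
      ∃ P Q : CrossSeq r, IsCCSolution T P Q ∧ IsLow (setJoin (seqSet P) (seqSet Q))) ∧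
    (∃ M : Set (Set ℕ), IsCrossConstraintIdeal r M ∧ ∀ A ∈ M, IsLow A) := by
  refine ⟨fun T hT hc => ?_, {B | ∃ k, SetTuringLE B (lowChain r k)},
    ⟨⟨⟨∅, 0, ?_⟩, ?_, ?_⟩, ?_⟩, ?_⟩
  · obtain ⟨P, Q, B, h1, -, h2, h3⟩ := exists_low_solution hT (setTuringLE_codeSet_empty hc)
    exact ⟨P, Q, h1, IsLow.of_le h3 h2⟩
  · rw [lowChain]
    exact setTuringLE_refl _
  · rintro A ⟨k, hk⟩ B ⟨m, hm⟩
    exact ⟨max k m, setTuringLE_setJoin (hk.trans (lowChain_mono r (le_max_left _ _)))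
      (hm.trans (lowChain_mono r (le_max_right _ _)))⟩
  · rintro A ⟨k, hk⟩ B hB
    exact ⟨k, hB.trans hk⟩
  · rintro T hT ⟨k, hk⟩
    obtain ⟨m, P, Q, h1, h2⟩ := lowChain_solution hT hk
    exact ⟨P, Q, h1, m, h2⟩
  · rintro A ⟨k, hk⟩
    exact (isLow_lowChain r k).of_le hk
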